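/- Let $m\ge 2$. A sequence $\sigma=J_1,\dots,J_n$ of jobs with processing times $p_1,\dots,p_n\ge 0$ arrives online, one job at a time, and must be scheduled non-preemptively on $m$ identical machines $M_1,\dots,M_m$ so as to minimize the makespan (the maximum machine load); $\mathrm{OPT}$ denotes the optimum offline makespan. For real $\alpha>1$ put $$f_m(\alpha)=(\alpha-1)\bigl(H_{m-1}-H_{\lceil(1-1/\alpha)m\rceil-1}\bigr)+\lceil(1-1/\alpha)m\rceil\,\frac{\alpha}{m},$$ where $H_k=\sum_{i=1}^k 1/i$ and $H_0=0$. The algorithm $ALG(\alpha)$ is defined as follows. Let $p_t^+=\sum_{i\le t}p_i$, let $p_t^i$ be the $i$-th largest processing time among $J_1,\dots,J_t$ (and $0$ if $i>t$), and let $L_t=\max\{\frac1m p_t^+,\,3p_t^{2m+1}\}$. A job $J_i$, $i\le t$, is small at time $t$ if $p_i\le(\alpha-1)L_t$, and large at time $t$ otherwise. Let $L_t^*=\frac1m\bigl(p_t^+-\sum_{i=1}^{2m}\hat p_t^i\bigr)$, where $\hat p_t^i=p_t^i$ if $p_t^i>(\alpha-1)L_t$ and $\hat p_t^i=0$ otherwise.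 Let $\beta(j)=(\alpha-1)\frac{m}{m-j}$ if $j\le\lfloor m/\alpha\rfloor$ and $\beta(j)=\alpha$ otherwise. Write $L=L_n$ and $L^*=L_n^*$ (both $0$ if $n=0$). *Job arrival phase.* For $t=1,\dots,n$: if $J_t$ is small at time $t$, it is assigned to some machine $M_j$ for which the jobs currently on $M_j$ that are small at time $t$ have total processing time at most $\beta(j)L_t^*$; if $J_t$ is large at time $t$, it is assigned to a least loaded machine. *Job migration phase.* Removal step: as long as there is a machine $M_j$ whose load exceeds $\max\{\beta(j)L^*,(\alpha-1)L\}$, a job of largest processing time on such a machine is removed and put into a set $R$ (initially empty). Reassignment step: sort the jobs of $R$ with processing time greater than $(\alpha-1)L$ in order of non-increasing processing time, $J_r^1,J_r^2,\dots$, with processing times $p_r^1\ge p_r^2\ge\cdots$. For $i=1,\dots,m$ the set $P_i$ contains $J_r^i$, if this job exists, and also $J_r^{2m+1-i}$, if this job exists and $p_r^{2m+1-i}>p_r^i/2$. In order of non-increasing total processing time, each set $P_i$ is assigned as a whole to a machine that is currently least loaded. Finally the remaining jobs of $R$ are assigned one by one, in arbitrary order, each to a machine that is currently least loaded. All ties and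 all choices left open are resolved arbitrarily. The number of job migrations is the number $|R|$ of removed jobs. **Theorem.** For every $m\ge2$ there is exactly one real $\alpha_m>1$ with $f_m(\alpha_m)=1$. The algorithm $ALG(\alpha_m)$ is $\alpha_m$-competitive: on every job sequence, and however the open choices are resolved, it never gets stuck (in particular, in the arrival phase a machine as required for a small job always exists), it terminates, and it ends with a schedule of all jobs whose makespan is at most $\alpha_m\cdot\mathrm{OPT}$. Moreover it uses at most $$\Bigl(\Bigl\lceil\frac{2-\alpha_m}{(\alpha_m-1)^2}\Bigr\rceil+4\Bigr)m$$ job migrations, and this number is at most $7m$ for every $m\ge 11$. -/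

import Mathlib

namespace MakespanMigration

open Finset

/-- `f_m(α) = (α-1)(H_{m-1} - H_{⌈(1-1/α)m⌉-1}) + ⌈(1-1/α)m⌉ α/m`, used for `m ≥ 2`, `α > 1`. -/
noncomputable def f (m : ℕ) (α : ℝ) : ℝ :=
  (α - 1) * ((harmonic (m - 1) : ℝ) - (harmonic (⌈(1 - 1 / α) * (m : ℝ)⌉₊ - 1) : ℝ))
    + (⌈(1 - 1 / α) * (m : ℝ)⌉₊ : ℝ) * α / (m : ℝ)

section Instance

variable {n m : ℕ}

/-- The makespan of the complete schedule that puts job `i` on machine `a i`. -/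
noncomputable def makespan (p : Fin n → ℝ) (a : Fin n → Fin m) : ℝ :=
  ⨆ j : Fin m, ∑ i with a i = j, p i

/-- The optimum (offline) makespan on `m` identical machines. -/
noncomputable def opt (m : ℕ) (p : Fin n → ℝ) : ℝ :=
  ⨅ a : Fin n → Fin m, makespan p a

/-- `p_t^+`: total processing time of the first `t` jobs. -/
noncomputable def prefixSum (p : Fin n → ℝ) (t : ℕ) : ℝ :=
  ∑ i with i.val < t, p i

/-- `p_t^k` (`k ≥ 1`): processing time of the `k`-th largest of the first `t` jobs,
and `0` if there are fewer than `k` of them. -/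
noncomputable def kthLargest (p : Fin n → ℝ) (t k : ℕ) : ℝ :=
  ((Multiset.map p (univ.filter fun i : Fin n => i.val < t).val).sort (· ≥ ·)).getD (k - 1) 0

/-- `L_t = max {p_t^+ / m, 3 p_t^{2m+1}}`. -/
noncomputable def lowerBound (m : ℕ) (p : Fin n → ℝ) (t : ℕ) : ℝ :=
  max (1 / (m : ℝ) * prefixSum p t) (3 * kthLargest p t (2 * m + 1))

/-- A job with processing time `x` is small at time `t` if `x ≤ (α-1) L_t`,
and large at time `t` otherwise. -/
def IsSmallAt (m : ℕ) (α : ℝ) (p : Fin n → ℝ) (t : ℕ) (x : ℝ) : Prop :=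
  x ≤ (α - 1) * lowerBound m p t

open Classical in
/-- `L*_t = (p_t^+ - ∑_{k=1}^{2m} p̂_t^k) / m`, where `p̂_t^k` is `p_t^k` if this is large at
time `t` and `0` otherwise. -/
noncomputable def smallAverage (m : ℕ) (α : ℝ) (p : Fin n → ℝ) (t : ℕ) : ℝ :=
  1 / (m : ℝ) * (prefixSum p t - ∑ k ∈ Icc 1 (2 * m),
    if IsSmallAt m α p t (kthLargest p t k) then 0 else kthLargest p t k)

/-- `β(j)` for the machine with number `j.val + 1`. -/
noncomputable def beta (α : ℝ) (j : Fin m) : ℝ :=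
  if j.val + 1 ≤ ⌊(m : ℝ) / α⌋₊ then (α - 1) * ((m : ℝ) / ((m : ℝ) - ((j.val : ℝ) + 1))) else α

/-- A partial schedule: `s i = some j` if job `i` currently resides on machine `j`, and
`s i = none` if it currently resides on no machine. -/
abbrev Sched (n m : ℕ) : Type := Fin n → Option (Fin m)

/-- The current load of machine `j`. -/
noncomputable def load (p : Fin n → ℝ) (s : Sched n m) (j : Fin m) : ℝ :=
  ∑ i with s i = some j, p i

open Classical in
/-- The current load of machine `j` caused by jobs that are small at time `t`. -/
noncomputable def smallLoad (α : ℝ) (p : Fin n → ℝ) (t : ℕ) (s : Sched n m) (j : Fin m) : ℝ :=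
  ∑ i with s i = some j ∧ IsSmallAt m α p t (p i), p i

/-- Machine `j` has the smallest current load. -/
def IsLeastLoaded (p : Fin n → ℝ) (s : Sched n m) (j : Fin m) : Prop :=
  ∀ j' : Fin m, load p s j ≤ load p s j'

/-- Put all jobs of `B` on machine `j`. -/
def place (s : Sched n m) (B : Finset (Fin n)) (j : Fin m) : Sched n m :=
  fun i => if i ∈ B then some j else s i

/-- The load of machine `j` exceeds `max {β(j) L*, (α-1) L}`, where `L = L_n`, `L* = L*_n`. -/
def Overloaded (α : ℝ) (p : Fin n → ℝ) (s : Sched n m) (j : Fin m) : Prop :=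
  max (beta α j * smallAverage m α p n) ((α - 1) * lowerBound m p n) < load p s j

/-- `r` lists the jobs of `R'` (the jobs of `R` that are large at the end) in order of
non-increasing processing time. -/
def IsSortedLarge (m : ℕ) (α : ℝ) (p : Fin n → ℝ) (R : Finset (Fin n)) (r : List (Fin n)) :
    Prop :=
  r.Nodup ∧ (∀ i, i ∈ r ↔ i ∈ R ∧ ¬ IsSmallAt m α p n (p i)) ∧
    r.Pairwise fun i i' => p i' ≤ p i

open Classical in
/-- The set `P_{i+1}`, for the sorted list `r = [J_r^1, J_r^2, …]`: it contains `J_r^{i+1}`, if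
this exists, and `J_r^{2m+1-(i+1)}`, if this exists and is longer than half of `J_r^{i+1}`.
(List positions start at `0`.) -/
noncomputable def pairSet (p : Fin n → ℝ) (r : List (Fin n)) (i : Fin m) : Finset (Fin n) :=
  univ.filter fun x => r[i.val]? = some x ∨
    (r[2 * m - 1 - i.val]? = some x ∧ ∃ y, r[i.val]? = some y ∧ p y / 2 < p x)

/-- `Bs` is a possible order of work of the reassignment step for the set `R` of removed jobs:
first the sets `P_1, …, P_m` in order of non-increasing total processing time, then the remaining
jobs of `R`, one by one, in an arbitrary order. -/
def IsReassignmentOrder (m : ℕ) (α : ℝ) (p : Fin n → ℝ) (R : Finset (Fin n))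
    (Bs : List (Finset (Fin n))) : Prop :=
  ∃ (r : List (Fin n)) (π : Equiv.Perm (Fin m)) (q : List (Fin n)),
    IsSortedLarge m α p R r ∧
    (Antitone fun k : Fin m => ∑ i ∈ pairSet p r (π k), p i) ∧
    q.Nodup ∧ (∀ i, i ∈ q ↔ i ∈ R ∧ ∀ k : Fin m, i ∉ pairSet p r k) ∧
    Bs = (List.ofFn fun k : Fin m => pairSet p r (π k)) ++ q.map fun i => {i}

/-- Configurations of the algorithm.
* `arrival t s`: the first `t` jobs have been assigned, with schedule `s`;
* `removal s R`: in the removal step; the set of removed jobs is `R`;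
* `reassign s R Bs`: in the reassignment step; the sets in `Bs` still have to be assigned;
* `done s R`: terminated with schedule `s`, the set of removed (migrated) jobs being `R`. -/
inductive Config (n m : ℕ) : Type
  | arrival (t : ℕ) (s : Sched n m) : Config n m
  | removal (s : Sched n m) (R : Finset (Fin n)) : Config n m
  | reassign (s : Sched n m) (R : Finset (Fin n)) (Bs : List (Finset (Fin n))) : Config n m
  | done (s : Sched n m) (R : Finset (Fin n)) : Config n m

/-- The steps of `ALG(α)` on the job sequence `p 0, …, p (n-1)`. All choices that the algorithm
leaves open are left open. The job `p t` arrives at time `t + 1`. -/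
inductive Step (α : ℝ) (p : Fin n → ℝ) : Config n m → Config n m → Prop
  | assignSmall (t : Fin n) (s : Sched n m) (j : Fin m)
      (hsmall : IsSmallAt m α p (t.val + 1) (p t))
      (hj : smallLoad α p (t.val + 1) s j ≤ beta α j * smallAverage m α p (t.val + 1)) :
      Step α p (.arrival t.val s) (.arrival (t.val + 1) (place s {t} j))
  | assignLarge (t : Fin n) (s : Sched n m) (j : Fin m)
      (hlarge : ¬ IsSmallAt m α p (t.val + 1) (p t))
      (hj : IsLeastLoaded p s j) :
      Step α p (.arrival t.val s) (.arrival (t.val + 1) (place s {t} j))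
  | startRemoval (s : Sched n m) : Step α p (.arrival n s) (.removal s ∅)
  | remove (s : Sched n m) (R : Finset (Fin n)) (j : Fin m) (i : Fin n)
      (hj : Overloaded α p s j)
      (hi : s i = some j) (hmax : ∀ i', s i' = some j → p i' ≤ p i) :
      Step α p (.removal s R) (.removal (Function.update s i none) (insert i R))
  | startReassign (s : Sched n m) (R : Finset (Fin n)) (Bs : List (Finset (Fin n)))
      (hload : ∀ j, ¬ Overloaded α p s j)
      (hBs : IsReassignmentOrder m α p R Bs) :
      Step α p (.removal s R) (.reassign s R Bs)
  | assignSet (s : Sched n m) (R : Finset (Fin n)) (B : Finset (Fin n))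
      (Bs : List (Finset (Fin n))) (j : Fin m)
      (hj : IsLeastLoaded p s j) :
      Step α p (.reassign s R (B :: Bs)) (.reassign (place s B j) R Bs)
  | finish (s : Sched n m) (R : Finset (Fin n)) : Step α p (.reassign s R []) (.done s R)

/-- The initial configuration: no job has been assigned. -/
def Config.init (n m : ℕ) : Config n m := .arrival 0 fun _ => none

/-- Configurations that occur in some execution of `ALG(α)` on the job sequence `p`. -/
def Reachable (α : ℝ) (p : Fin n → ℝ) (c : Config n m) : Prop :=
  Relation.ReflTransGen (Step α p) (Config.init n m) c

/-- `ALG(α)` is well-defined on `p` with `m` machines: no execution gets stuck before it is done,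
and every execution terminates. -/
def WellDefined (m : ℕ) (α : ℝ) (p : Fin n → ℝ) : Prop :=
  (∀ c : Config n m, Reachable α p c →
    (∃ s R, c = .done s R) ∨ ∃ c' : Config n m, Step α p c c') ∧
  Acc (fun c' c : Config n m => Step α p c c') (Config.init n m)

end Instance

/-- `ALG(α)` on `m` machines is `c`-competitive: on every job sequence it is well-defined, and
every execution ends with a complete schedule whose makespan is at most `c` times the optimum. -/
def IsCompetitive (m : ℕ) (α c : ℝ) : Prop :=
  ∀ (n : ℕ) (p : Fin n → ℝ), (∀ i, 0 ≤ p i) →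
    WellDefined m α p ∧
    ∀ (s : Sched n m) (R : Finset (Fin n)), Reachable α p (.done s R) →
      ∃ a : Fin n → Fin m, (∀ i, s i = some (a i)) ∧ makespan p a ≤ c * opt m p

/-- On every job sequence, every execution of `ALG(α)` on `m` machines migrates at most `k` jobs
(each removed job counts, even if it is put back on the machine from which it was removed). -/
def MigratesAtMost (m : ℕ) (α : ℝ) (k : ℤ) : Prop :=
  ∀ (n : ℕ) (p : Fin n → ℝ), (∀ i, 0 ≤ p i) →
    ∀ (s : Sched n m) (R : Finset (Fin n)), Reachable α p (.done s R) → (R.card : ℤ) ≤ k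

end MakespanMigration

namespace MakespanMigration
open Finset

/-! Write O for the optimum and L, L* for the final bounds.

Root and arrival. `f m α` is the average of the weights β(j), and each weight is a continuous,
strictly increasing function of α (`weight`). Hence f = 1 has exactly one solution once f(4/3) ≤ 1 ≤
f(2) is known. That solution is at least 4/3, which drives the rest: the (2m+1)-st longest job has
length at most L_t/3 ≤ (α-1)L_t, so it is small, and mL*_t is exactly the total length of the small
jobs (`mul_smallAverage`). As the weights sum to m, the small loads cannot exceed β(j)L*_t on every
machine, so a small job always finds a place.

Makespan. Every set P_i has total length at most O (`sum_pairSet_le_opt`). When the (k+1)-st set, of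
total x, is assigned, k+1 disjoint sets of total at least x and the small jobs together have volume
at most mO. This is just enough to give β(j)L* + x ≤ αO for every j ≤ k+1 (`weight_mul_add_le`), and
one of these k+1 machines has not yet received a set. Every remaining removed job has length at most
(α-1)O, and a least loaded machine has load at most O (`fits_of_isReassignmentOrder`,
`ReassignInvariant.place`).

Migrations. Removing longest jobs first is optimal, so it suffices to exhibit, for each machine,
some set of ⌈(2-α)/(α-1)²⌉ + 4 jobs whose removal would do (`card_le_card_of_greedy`,
`exists_removals`). The bound 7m comes from α_m ≥ 33/23 for m ≥ 11. -/

/-! ### The weights β(j) and their average f. -/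

/-- The weight `β(j)` of the machine with number `j + 1`, as a continuous function of `α`. -/
noncomputable def weight (m j : ℕ) (α : ℝ) : ℝ :=
  if j + 1 < m then min ((α - 1) * ((m : ℝ) / ((m : ℝ) - ((j : ℝ) + 1)))) α else α

/-- The quotient stays below α exactly when (j+1)α ≤ m, that is, when j+1 ≤ ⌊m/α⌋. Written as a
minimum, the weight shows no jumps in α despite the floor. -/
lemma beta_eq_weight {m : ℕ} {α : ℝ} (hα : 1 < α) (j : Fin m) : beta α j = weight m j α := by
  have hm : (0 : ℝ) < m := by exact_mod_cast (Nat.zero_lt_of_lt j.2)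
  have hfl : j.val + 1 ≤ ⌊(m : ℝ) / α⌋₊ ↔ ((j.val : ℝ) + 1) * α ≤ m := by
    rw [Nat.le_floor_iff (by positivity), le_div_iff₀ (by linarith)]
    push_cast; rfl
  unfold beta weight
  by_cases hj : j.val + 1 < m
  · have hj' : (0 : ℝ) < (m : ℝ) - ((j.val : ℝ) + 1) := by
      have : ((j.val + 1 : ℕ) : ℝ) < m := by exact_mod_cast hj
      push_cast at this; linarith
    rw [if_pos hj]
    have key : (α - 1) * ((m : ℝ) / ((m : ℝ) - ((j.val : ℝ) + 1))) ≤ α ↔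
        ((j.val : ℝ) + 1) * α ≤ m := by
      rw [← mul_div_assoc, div_le_iff₀ hj']
      constructor <;> intro h <;> nlinarith
    split_ifs with h
    · rw [min_eq_left (key.2 (hfl.1 h))]
    · rw [min_eq_right]
      by_contra h'
      exact h (hfl.2 (key.1 (not_le.1 h').le))
  · rw [if_neg hj, if_neg]
    rw [hfl]
    have : ((j.val + 1 : ℕ) : ℝ) = m := by
      have := j.2
      exact_mod_cast (by omega : j.val + 1 = m)
    push_cast at this
    rw [this]
    nlinarith

lemma weight_continuous (m j : ℕ) : Continuous (weight m j) := by
  unfold weight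
  split_ifs <;> fun_prop

lemma weight_strictMono (m j : ℕ) : StrictMono (weight m j) := by
  intro a b hab
  unfold weight
  split_ifs with h
  · have hj' : (0 : ℝ) < (m : ℝ) - ((j : ℝ) + 1) := by
      have : ((j + 1 : ℕ) : ℝ) < m := by exact_mod_cast h
      push_cast at this; linarith
    have hm : (0 : ℝ) < m := by exact_mod_cast (by omega : 0 < m)
    have hpos : 0 < (m : ℝ) / ((m : ℝ) - ((j : ℝ) + 1)) := by positivity
    apply lt_min
    · exact (min_le_left _ _).trans_lt (by nlinarith)
    · exact (min_le_right _ _).trans_lt hab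
  · exact hab

lemma weight_mono {m i j : ℕ} (hij : i ≤ j) {α : ℝ} (hα : 1 < α) :
    weight m i α ≤ weight m j α := by
  unfold weight
  split_ifs with h1 h2 h2
  · apply min_le_min_right
    have hj' : (0 : ℝ) < (m : ℝ) - ((j : ℝ) + 1) := by
      have : ((j + 1 : ℕ) : ℝ) < m := by exact_mod_cast h2
      push_cast at this; linarith
    have hij' : (i : ℝ) ≤ j := by exact_mod_cast hij
    apply mul_le_mul_of_nonneg_left _ (by linarith)
    apply div_le_div_of_nonneg_left (by positivity) hj' (by linarith)
  · exact min_le_right _ _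
  · omega
  · exact le_rfl

lemma weight_le {m j : ℕ} (α : ℝ) : weight m j α ≤ α := by
  unfold weight
  split_ifs
  exacts [min_le_right _ _, le_rfl]

lemma weight_nonneg {m j : ℕ} {α : ℝ} (hα : 1 < α) : 0 ≤ weight m j α := by
  unfold weight
  split_ifs with h
  · have hj' : (0 : ℝ) < (m : ℝ) - ((j : ℝ) + 1) := by
      have : ((j + 1 : ℕ) : ℝ) < m := by exact_mod_cast h
      push_cast at this; linarith
    have : 0 ≤ α - 1 := by linarith
    exact le_min (by positivity) (by linarith)
  · linarith

lemma ceil_eq_sub_floor {m : ℕ} {α : ℝ} (hα : 1 < α) :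
    ⌈(1 - 1 / α) * (m : ℝ)⌉₊ = m - ⌊(m : ℝ) / α⌋₊ := by
  have h1 : (1 - 1 / α) * (m : ℝ) = (m : ℝ) - (m : ℝ) / α := by ring
  have hle : (m : ℝ) / α ≤ m := div_le_self (by positivity) hα.le
  have hfl : ⌊(m : ℝ) / α⌋₊ ≤ m := Nat.floor_le_of_le hle
  have h2 := Nat.floor_le (show 0 ≤ (m : ℝ) / α by positivity)
  have h3 := Nat.lt_floor_add_one ((m : ℝ) / α)
  rw [h1]
  apply le_antisymm
  · rw [Nat.ceil_le]
    push_cast [hfl]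
    linarith
  · have := Nat.le_ceil ((m : ℝ) - (m : ℝ) / α)
    have h5 : ((m : ℕ) : ℝ) < ((⌈(m : ℝ) - (m : ℝ) / α⌉₊ + ⌊(m : ℝ) / α⌋₊ + 1 : ℕ) : ℝ) := by
      push_cast; linarith
    have : m < ⌈(m : ℝ) - (m : ℝ) / α⌉₊ + ⌊(m : ℝ) / α⌋₊ + 1 := by exact_mod_cast h5
    omega

lemma sum_reciprocals_eq_harmonic_sub (m q : ℕ) (hq : q < m) :
    ∑ j ∈ range q, (1 : ℝ) / ((m : ℝ) - ((j : ℝ) + 1)) =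
      (harmonic (m - 1) : ℝ) - (harmonic (m - q - 1) : ℝ) := by
  induction q with
  | zero => simp
  | succ q ih =>
    rw [sum_range_succ, ih (by omega)]
    have h1 : m - q - 1 = (m - (q + 1) - 1) + 1 := by omega
    rw [h1, harmonic_succ]
    have h2 : ((m - (q + 1) - 1 + 1 : ℕ) : ℝ) = (m : ℝ) - ((q : ℝ) + 1) := by
      have : m - (q + 1) - 1 + 1 = m - (q + 1) := by omega
      rw [this, Nat.cast_sub (by omega)]; push_cast; ring
    push_cast at h2 ⊢
    rw [h2]; ring

/-- This explains the form of f: the condition f = 1 says that the weights sum to m. -/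
lemma sum_beta {m : ℕ} (hm : 2 ≤ m) {α : ℝ} (hα : 1 < α) :
    ∑ j : Fin m, beta α j = m * f m α := by
  set q := ⌊(m : ℝ) / α⌋₊ with hq
  have hm0 : (0 : ℝ) < m := by exact_mod_cast (by omega : 0 < m)
  have hqm : q < m := by
    rw [hq, Nat.floor_lt (by positivity), div_lt_iff₀ (by linarith)]
    nlinarith
  have e1 : ∑ j : Fin m, beta α j = ∑ j ∈ range m,
      if j + 1 ≤ q then (α - 1) * ((m : ℝ) / ((m : ℝ) - ((j : ℝ) + 1))) else α := by
    rw [sum_range]; rfl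
  have hcut : m = q + (m - q) := by omega
  have e2 : ∑ j ∈ range m, (if j + 1 ≤ q then
      (α - 1) * ((m : ℝ) / ((m : ℝ) - ((j : ℝ) + 1))) else α) =
      ∑ j ∈ range q, (α - 1) * (m * (1 / ((m : ℝ) - ((j : ℝ) + 1)))) +
        ((m - q : ℕ) : ℝ) * α := by
    rw [← sum_range_add_sum_Ico _ hqm.le]
    congr 1
    · apply sum_congr rfl
      intro j hj
      rw [mem_range] at hj
      rw [if_pos (by omega)]; ring
    · rw [sum_congr rfl (g := fun _ => α)]
      · simp
      · intro j hj
        rw [mem_Ico] at hj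
        rw [if_neg (by omega)]
  rw [e1, e2, ← mul_sum, ← mul_sum, sum_reciprocals_eq_harmonic_sub m q hqm, f,
    ceil_eq_sub_floor hα, ← hq]
  field_simp

lemma f_eq_weight {m : ℕ} (hm : 2 ≤ m) {α : ℝ} (hα : 1 < α) :
    m * f m α = ∑ j : Fin m, weight m j α := by
  rw [← sum_beta hm hα]
  exact sum_congr rfl fun j _ => beta_eq_weight hα j

lemma f_strictMono {m : ℕ} (hm : 2 ≤ m) {a b : ℝ} (ha : 1 < a) (hab : a < b) :
    f m a < f m b := by
  have hm0 : (0 : ℝ) < m := by exact_mod_cast (by omega : 0 < m)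
  have : m * f m a < m * f m b := by
    rw [f_eq_weight hm ha, f_eq_weight hm (ha.trans hab)]
    exact sum_lt_sum_of_nonempty ⟨⟨0, by omega⟩, mem_univ _⟩
      fun j _ => weight_strictMono m j hab
  exact lt_of_mul_lt_mul_left this hm0.le

lemma one_le_f_two {m : ℕ} (hm : 2 ≤ m) : 1 ≤ f m 2 := by
  have hm0 : (0 : ℝ) < m := by exact_mod_cast (by omega : 0 < m)
  have h : (m : ℝ) * 1 ≤ m * f m 2 := by
    rw [f_eq_weight hm (by norm_num)]
    have : ∑ j : Fin m, (1 : ℝ) ≤ ∑ j : Fin m, weight m j 2 := by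
      apply sum_le_sum
      intro j _
      unfold weight
      split_ifs with h
      · have hj' : (0 : ℝ) < (m : ℝ) - ((j : ℝ) + 1) := by
          have : ((j + 1 : ℕ) : ℝ) < m := by exact_mod_cast h
          push_cast at this; linarith
        refine le_min ?_ (by norm_num)
        rw [show (2 : ℝ) - 1 = 1 by norm_num, one_mul, le_div_iff₀ hj']
        have : (0 : ℝ) ≤ (j : ℕ) := by positivity
        linarith
      · norm_num
    simpa using this
  exact le_of_mul_le_mul_left h hm0

/-! ### Numerical bounds on f at 4/3 and 33/23. -/

/-- The hypotheses say k = ⌈m/4⌉, and the conclusion is f(4/3) ≤ 1 cleared of factors. The induction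
passes from (m, k) to (m+4, k+1), which keeps the rounding error. -/
lemma harmonic_sub_le_of_quarter (k : ℕ) : ∀ m : ℕ, 2 ≤ m → 1 ≤ k → m ≤ 4 * k → 4 * k ≤ m + 3 →
    (harmonic (m - 1) : ℝ) - (harmonic (k - 1) : ℝ) ≤ 3 - 4 * k / m := by
  induction k with
  | zero => intro m _ h; omega
  | succ k ih =>
    intro m hm _ h1 h2
    -- m = 5 is a base case too, since going back by four would leave m = 1.
    by_cases hk : k = 0 ∨ m = 5
    · have hmk : (m = 2 ∧ k = 0) ∨ (m = 3 ∧ k = 0) ∨ (m = 4 ∧ k = 0) ∨ (m = 5 ∧ k = 1) := by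
        omega
      rcases hmk with ⟨rfl, rfl⟩ | ⟨rfl, rfl⟩ | ⟨rfl, rfl⟩ | ⟨rfl, rfl⟩ <;>
        norm_num [harmonic, sum_range_succ]
    · push Not at hk
      obtain ⟨l, rfl⟩ : ∃ l, m = l + 4 := ⟨m - 4, by omega⟩
      have := ih l (by omega) (by omega) (by omega) (by omega)
      obtain ⟨k', rfl⟩ : ∃ k', k = k' + 1 := ⟨k - 1, by omega⟩
      obtain ⟨l', rfl⟩ : ∃ l', l = l' + 2 := ⟨l - 2, by omega⟩
      have hh1 : (harmonic (l' + 2 + 4 - 1) : ℝ) = (harmonic (l' + 2 - 1) : ℝ) +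
          1 / ((l' : ℝ) + 2) + 1 / ((l' : ℝ) + 3) + 1 / ((l' : ℝ) + 4) + 1 / ((l' : ℝ) + 5) := by
        rw [show l' + 2 + 4 - 1 = l' + 1 + 1 + 1 + 1 + 1 by omega,
          show l' + 2 - 1 = l' + 1 by omega]
        rw [harmonic_succ (l' + 1 + 1 + 1 + 1), harmonic_succ (l' + 1 + 1 + 1),
          harmonic_succ (l' + 1 + 1), harmonic_succ (l' + 1)]
        push_cast
        ring_nf
      have hh2 : (harmonic (k' + 1 + 1 - 1) : ℝ) = (harmonic (k' + 1 - 1) : ℝ) +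
          1 / ((k' : ℝ) + 1) := by
        rw [show k' + 1 + 1 - 1 = k' + 1 by omega, show k' + 1 - 1 = k' by omega, harmonic_succ]
        push_cast
        ring_nf
      rw [hh1, hh2]
      have key : 1 / ((l' : ℝ) + 2) + 1 / ((l' : ℝ) + 3) + 1 / ((l' : ℝ) + 4) +
          1 / ((l' : ℝ) + 5) - 1 / ((k' : ℝ) + 1) ≤
          4 * ((k' : ℝ) + 1) / ((l' : ℝ) + 2) - 4 * ((k' : ℝ) + 2) / ((l' : ℝ) + 6) := by
        -- c encodes the residue of m modulo 4; for each residue the claim is a rational inequality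
        -- in one variable.
        obtain ⟨c, hc, hk'⟩ : ∃ c : ℝ, (c = 2 ∨ c = 3 ∨ c = 4 ∨ c = 5) ∧
            (k' : ℝ) + 1 = ((l' : ℝ) + c) / 4 := by
          refine ⟨4 * (k' + 1) - l', ?_, by ring⟩
          have : 4 * (k' + 1) = l' + 2 ∨ 4 * (k' + 1) = l' + 3 ∨ 4 * (k' + 1) = l' + 4 ∨
            4 * (k' + 1) = l' + 5 := by omega
          simp only [sub_eq_iff_eq_add', ← Nat.cast_ofNat (R := ℝ)]
          exact_mod_cast this
        rcases hc with rfl | rfl | rfl | rfl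
        all_goals
          have hk2 : (k' : ℝ) + 2 = ((k' : ℝ) + 1) + 1 := by ring
          rw [hk2, hk']
          have hl : (0 : ℝ) ≤ l' := by positivity
          generalize (l' : ℝ) = x at *
          rw [← sub_nonneg]
          field_simp
          ring_nf
          positivity
      push_cast at this ⊢
      ring_nf at this key ⊢
      linarith

lemma f_four_thirds_le {m : ℕ} (hm : 2 ≤ m) : f m (4 / 3) ≤ 1 := by
  have hm0 : (0 : ℝ) < m := by exact_mod_cast (by omega : 0 < m)
  unfold f
  have e : (1 - 1 / (4 / 3 : ℝ)) * (m : ℝ) = m / 4 := by ring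
  rw [e]
  set k := ⌈(m : ℝ) / 4⌉₊ with hk
  have h1 : (m : ℝ) ≤ 4 * k := by
    have := Nat.le_ceil ((m : ℝ) / 4); linarith
  have h2 : (4 * k : ℝ) < m + 4 := by
    have := Nat.ceil_lt_add_one (show 0 ≤ (m : ℝ) / 4 by positivity); linarith
  have h1' : m ≤ 4 * k := by exact_mod_cast h1
  have h2' : 4 * k < m + 4 := by exact_mod_cast h2
  have := harmonic_sub_le_of_quarter k m hm (by omega) h1' (by omega)
  have e2 : (k : ℝ) * (4 / 3) / m = (4 * k / m) / 3 := by ring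
  rw [e2]
  linarith

/-- Each term satisfies 1/i ≤ log((2i+1)/(2i-1)), and these logarithms telescope. -/
lemma harmonic_sub_le_log {k : ℕ} (hk : 1 ≤ k) (d : ℕ) :
    (harmonic (k + d - 1) : ℝ) - (harmonic (k - 1) : ℝ) ≤
      Real.log ((2 * ((k + d : ℕ) : ℝ) - 1) / (2 * k - 1)) := by
  have hk' : (1 : ℝ) ≤ k := by exact_mod_cast hk
  induction d with
  | zero => simp [div_self (show (2 * (k : ℝ) - 1) ≠ 0 by linarith)]
  | succ d ih =>
    have e : (harmonic (k + (d + 1) - 1) : ℝ) = (harmonic (k + d - 1) : ℝ) +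
        1 / ((k + d : ℕ) : ℝ) := by
      rw [show k + (d + 1) - 1 = (k + d - 1) + 1 by omega, harmonic_succ,
        show k + d - 1 + 1 = k + d by omega]
      push_cast; ring
    rw [e]
    set i : ℝ := ((k + d : ℕ) : ℝ) with hi
    have hi1 : 1 ≤ i := by rw [hi]; exact_mod_cast (by omega : 1 ≤ k + d)
    have e2 : ((k + (d + 1) : ℕ) : ℝ) = i + 1 := by rw [hi]; push_cast; ring
    rw [e2]
    have e3 : (2 * (i + 1) - 1) / (2 * (k : ℝ) - 1) =
        (1 + 2 / (2 * i - 1)) * ((2 * i - 1) / (2 * k - 1)) := by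
      have : 2 * i - 1 ≠ 0 := by linarith
      have : 2 * (k : ℝ) - 1 ≠ 0 := by linarith
      field_simp; ring
    have hpos : 0 < 2 / (2 * i - 1) := div_pos (by norm_num) (by linarith)
    rw [e3, Real.log_mul (by positivity)
      (div_pos (by linarith) (by linarith)).ne']
    have := Real.le_log_one_add_of_nonneg hpos.le
    have e4 : 2 * (2 / (2 * i - 1)) / (2 / (2 * i - 1) + 2) = 1 / i := by
      have : 2 * i - 1 ≠ 0 := by linarith
      have : i ≠ 0 := by linarith
      have : 2 / (2 * i - 1) + 2 ≠ 0 := by positivity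
      field_simp; ring
    rw [e4] at this
    linarith

lemma log_three_point_three_le : Real.log (33 / 10) ≤ 1195 / 1000 := by
  have h1 := Real.log_two_lt_d9
  have h2 := Real.le_log_one_add_of_nonneg (show (0 : ℝ) ≤ 7 / 33 by norm_num)
  have e : (33 / 10 : ℝ) = 2 ^ 2 / (1 + 7 / 33) := by norm_num
  rw [e, Real.log_div (by norm_num) (by norm_num), Real.log_pow]
  norm_num at h2 ⊢
  linarith

/-- At α = 33/23 the quotient (2-α)/(α-1)² is 299/100, just below 3. -/
lemma f_le_one_of_eleven_le {m : ℕ} (hm : 11 ≤ m) : f m (33 / 23) ≤ 1 := by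
  have hm0 : (0 : ℝ) < m := by exact_mod_cast (by omega : 0 < m)
  unfold f
  have e : (1 - 1 / (33 / 23 : ℝ)) * (m : ℝ) = 10 * m / 33 := by ring
  rw [e]
  set k := ⌈(10 * m : ℝ) / 33⌉₊ with hk
  have h1 : (10 * m : ℝ) ≤ 33 * k := by
    have := Nat.le_ceil ((10 * m : ℝ) / 33); linarith
  have h2 : (33 * k : ℝ) < 10 * m + 33 := by
    have := Nat.ceil_lt_add_one (show 0 ≤ (10 * m : ℝ) / 33 by positivity); linarith
  have h1' : 10 * m ≤ 33 * k := by exact_mod_cast h1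
  have h2' : 33 * k < 10 * m + 33 := by exact_mod_cast h2
  by_cases hs : m ≤ 13
  · have hc : (m = 11 ∧ k = 4) ∨ (m = 12 ∧ k = 4) ∨ (m = 13 ∧ k = 4) := by omega
    clear_value k
    rcases hc with ⟨rfl, rfl⟩ | ⟨rfl, rfl⟩ | ⟨rfl, rfl⟩ <;>
      norm_num [harmonic, sum_range_succ]
  · have hm14 : (14 : ℝ) ≤ m := by exact_mod_cast (by omega : 14 ≤ m)
    have hk1 : 1 ≤ k := by omega
    have hkR : (1 : ℝ) ≤ k := by exact_mod_cast hk1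
    have hlog := harmonic_sub_le_log hk1 (m - k)
    rw [show k + (m - k) = m by omega] at hlog
    have e3 : (2 * (m : ℝ) - 1) / (2 * k - 1) =
        33 / 10 * ((10 / 33) * (2 * m - 1) / (2 * k - 1)) := by ring
    have hy : 0 < (10 / 33) * (2 * (m : ℝ) - 1) / (2 * k - 1) :=
      div_pos (by linarith) (by linarith)
    rw [e3, Real.log_mul (by norm_num) hy.ne'] at hlog
    have h3 := Real.log_le_sub_one_of_pos hy
    have h4 := log_three_point_three_le
    -- The goal amounts to H_{m-1} - H_{k-1} + 3.3 k/m ≤ 2.3. After log 3.3 ≤ 1.195 and log y ≤ y -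
    -- 1, exactly 2.105 is left for y + 3.3 k/m.
    have key : (10 / 33) * (2 * (m : ℝ) - 1) / (2 * k - 1) + 33 / 10 * (k / m) ≤ 2105 / 1000 := by
      rw [← sub_nonneg]
      have hK : (0 : ℝ) < 2 * k - 1 := by linarith
      have : 2105 / 1000 - ((10 / 33) * (2 * (m : ℝ) - 1) / (2 * k - 1) + 33 / 10 * (k / m)) =
          (2105 / 1000 * (m * (2 * k - 1)) - (10 / 33) * (2 * m - 1) * m -
            33 / 10 * k * (2 * k - 1)) / (m * (2 * k - 1)) := by
        field_simp
        ring
      rw [this]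
      apply div_nonneg _ (by positivity)
      obtain ⟨δ, hδ⟩ : ∃ δ : ℝ, (k : ℝ) = 10 * m / 33 + δ := ⟨k - 10 * m / 33, by ring⟩
      have hδ0 : 0 ≤ δ := by linarith
      have hδ1 : δ ≤ 1 := by linarith
      rw [hδ]
      nlinarith [mul_nonneg hδ0 (sub_nonneg.2 hδ1), mul_nonneg (sub_nonneg.2 hm14) hm0.le,
        mul_nonneg hδ0 (sub_nonneg.2 hm14), mul_nonneg (sub_nonneg.2 hδ1) (sub_nonneg.2 hm14)]
    have e4 : (k : ℝ) * (33 / 23) / m = 33 / 23 * (k / m) := by ring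
    rw [e4]
    linarith

/-! ### The root α_m. -/

lemma continuousOn_f {m : ℕ} (hm : 2 ≤ m) : ContinuousOn (f m) (Set.Ioi 1) := by
  have hm0 : (m : ℝ) ≠ 0 := by exact_mod_cast (by omega : m ≠ 0)
  have : ContinuousOn (fun α => (∑ j : Fin m, weight m j α) / m) (Set.Ioi 1) :=
    ((continuous_finsetSum univ fun (j : Fin m) _ => weight_continuous m j).div_const
      (m : ℝ)).continuousOn
  refine this.congr fun α hα => ?_
  simp only
  rw [← f_eq_weight hm hα, mul_div_cancel_left₀ _ hm0]

lemma existsUnique_f_eq_one {m : ℕ} (hm : 2 ≤ m) : ∃! α : ℝ, 1 < α ∧ f m α = 1 := by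
  have hcont : ContinuousOn (f m) (Set.Icc (4 / 3) 2) :=
    (continuousOn_f hm).mono fun x hx => lt_of_lt_of_le (by norm_num) hx.1
  obtain ⟨α, hα, h1⟩ := intermediate_value_Icc (by norm_num) hcont
    ⟨f_four_thirds_le hm, one_le_f_two hm⟩
  refine ⟨α, ⟨lt_of_lt_of_le (by norm_num) hα.1, h1⟩, ?_⟩
  rintro b ⟨hb, hb1⟩
  have ha : 1 < α := lt_of_lt_of_le (by norm_num) hα.1
  rcases lt_trichotomy b α with h | h | h
  · have := f_strictMono hm hb h; linarith
  · exact h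
  · have := f_strictMono hm ha h; linarith

lemma le_of_f_le_one {m : ℕ} (hm : 2 ≤ m) {a α : ℝ} (hα : 1 < α) (h1 : f m α = 1)
    (ha : f m a ≤ 1) : a ≤ α := by
  by_contra! h
  have := f_strictMono hm hα h
  linarith

lemma le_two_of_f_eq_one {m : ℕ} (hm : 2 ≤ m) {α : ℝ} (h1 : f m α = 1) : α ≤ 2 := by
  by_contra! h
  have := f_strictMono hm (by norm_num) h
  linarith [one_le_f_two hm]

lemma ceil_le_three {m : ℕ} (hm : 11 ≤ m) {α : ℝ} (hα : 1 < α) (h1 : f m α = 1) :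
    ⌈(2 - α) / (α - 1) ^ 2⌉ ≤ 3 := by
  have := le_of_f_le_one (by omega) hα h1 (f_le_one_of_eleven_le hm)
  rw [Int.ceil_le, div_le_iff₀ (by have : 0 < α - 1 := by linarith
                                   positivity)]
  push_cast
  nlinarith


/-! ### Order statistics, and L* as the average small volume. -/

section Lists

/-- Positivity of x keeps the default value 0 past the end of the list from counting. -/
lemma le_getD_iff_lt_countP {x : ℝ} (hx : 0 < x) (l : List ℝ) (hl : l.Pairwise (· ≥ ·)) (k : ℕ) :
    x ≤ l.getD k 0 ↔ k < l.countP (x ≤ ·) := by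
  induction l generalizing k with
  | nil => simp [hx]
  | cons a l ih =>
    rw [List.pairwise_cons] at hl
    by_cases ha : x ≤ a
    · cases k with
      | zero => simp [ha]
      | succ k => simpa [ha] using ih hl.2 k
    · have h0 : l.countP (x ≤ ·) = 0 := by
        rw [List.countP_eq_zero]
        intro b hb
        have := hl.1 b hb
        simpa using lt_of_le_of_lt this (not_le.1 ha)
      have := ih hl.2
      simp only [h0, not_lt_zero, iff_false] at this
      cases k with
      | zero => simp [ha, h0]
      | succ k => simpa [ha, h0] using this k

lemma sum_range_getD {g : ℝ → ℝ} (hg : g 0 = 0) (l : List ℝ) (K : ℕ) (hK : l.length ≤ K) :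
    ∑ k ∈ range K, g (l.getD k 0) = (l.map g).sum := by
  induction l generalizing K with
  | nil => simp [hg]
  | cons a l ih =>
    cases K with
    | zero => simp at hK
    | succ K =>
      rw [sum_range_succ', List.map_cons, List.sum_cons]
      simp only [List.getD_cons_succ, List.getD_cons_zero]
      rw [ih K (by simpa using hK), add_comm]

end Lists

section Instance

variable {n m : ℕ} {α : ℝ} {p : Fin n → ℝ}

lemma le_kthLargest_iff {x : ℝ} (hx : 0 < x) (t k : ℕ) :
    x ≤ kthLargest p t (k + 1) ↔ k < #{i : Fin n | i.val < t ∧ x ≤ p i} := by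
  unfold kthLargest
  rw [Nat.add_sub_cancel, le_getD_iff_lt_countP hx _ (Multiset.pairwise_sort _ _)]
  have : List.countP (x ≤ ·) (((Multiset.map p (univ.filter fun i : Fin n => i.val < t).val).sort
      (· ≥ ·))) = #{i : Fin n | i.val < t ∧ x ≤ p i} := by
    rw [← Multiset.coe_countP, Multiset.sort_eq, Multiset.countP_map, ← filter_filter]
    rfl
  simp only [this]

lemma kthLargest_nonneg (hp : ∀ i, 0 ≤ p i) (t k : ℕ) : 0 ≤ kthLargest p t k := by
  unfold kthLargest
  rw [List.getD_eq_getElem?_getD]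
  cases h : (((Multiset.map p (univ.filter fun i : Fin n => i.val < t).val).sort
      (· ≥ ·)))[k - 1]? with
  | none => simp
  | some y =>
    have := List.mem_of_getElem? h
    rw [Multiset.mem_sort, Multiset.mem_map] at this
    obtain ⟨i, -, rfl⟩ := this
    exact hp i

lemma kthLargest_mono (hp : ∀ i, 0 ≤ p i) {t t' : ℕ} (h : t ≤ t') (k : ℕ) :
    kthLargest p t (k + 1) ≤ kthLargest p t' (k + 1) := by
  rcases (kthLargest_nonneg hp t (k + 1)).eq_or_lt with h0 | h0
  · rw [← h0]; exact kthLargest_nonneg hp _ _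
  · rw [le_kthLargest_iff h0]
    refine ((le_kthLargest_iff h0 t k).1 le_rfl).trans_le (card_le_card ?_)
    intro i
    simp only [mem_filter, mem_univ, true_and]
    exact fun hi => ⟨hi.1.trans_le h, hi.2⟩

lemma prefixSum_mono (hp : ∀ i, 0 ≤ p i) {t t' : ℕ} (h : t ≤ t') :
    prefixSum p t ≤ prefixSum p t' := by
  apply sum_le_sum_of_subset_of_nonneg
  · intro i
    simp only [mem_filter, mem_univ, true_and]
    exact fun hi => hi.trans_le h
  · exact fun i _ _ => hp i

lemma prefixSum_self (p : Fin n → ℝ) : prefixSum p n = ∑ i, p i := by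
  unfold prefixSum
  congr 1
  ext i
  simp

lemma lowerBound_mono (hp : ∀ i, 0 ≤ p i) {t t' : ℕ} (h : t ≤ t') :
    lowerBound m p t ≤ lowerBound m p t' := by
  apply max_le_max
  · exact mul_le_mul_of_nonneg_left (prefixSum_mono hp h) (by positivity)
  · exact mul_le_mul_of_nonneg_left (kthLargest_mono hp h _) (by norm_num)

lemma lowerBound_nonneg (hp : ∀ i, 0 ≤ p i) (t : ℕ) : 0 ≤ lowerBound m p t :=
  le_max_of_le_right (mul_nonneg (by norm_num) (kthLargest_nonneg hp _ _))

lemma prefixSum_le_mul_lowerBound (hm : 0 < m) (t : ℕ) :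
    prefixSum p t ≤ m * lowerBound m p t := by
  have hm0 : (0 : ℝ) < m := by exact_mod_cast hm
  have : 1 / (m : ℝ) * prefixSum p t ≤ lowerBound m p t := le_max_left _ _
  calc prefixSum p t = m * (1 / (m : ℝ) * prefixSum p t) := by field_simp
    _ ≤ _ := mul_le_mul_of_nonneg_left this hm0.le

lemma IsSmallAt.mono (hα : 1 < α) (hp : ∀ i, 0 ≤ p i) {t t' : ℕ} (h : t ≤ t') {x : ℝ}
    (hx : IsSmallAt m α p t x) : IsSmallAt m α p t' x :=
  le_trans hx (mul_le_mul_of_nonneg_left (lowerBound_mono hp h) (by linarith))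

open Classical in
-- From rank 2m+1 on, a job has length at most L_t/3 ≤ (α-1)L_t and is small. Cutting the sum at 2m
-- therefore loses no large job.
lemma sum_large_kthLargest (hα : 4 / 3 ≤ α) (hp : ∀ i, 0 ≤ p i) (t : ℕ) :
    (∑ k ∈ Icc 1 (2 * m),
      if IsSmallAt m α p t (kthLargest p t k) then 0 else kthLargest p t k) =
    ∑ i : Fin n with i.val < t ∧ ¬ IsSmallAt m α p t (p i), p i := by
  set l := ((Multiset.map p (univ.filter fun i : Fin n => i.val < t).val).sort (· ≥ ·)) with hl
  have hsort : l.Pairwise (· ≥ ·) := Multiset.pairwise_sort _ _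
  set g : ℝ → ℝ := fun x => if IsSmallAt m α p t x then 0 else x with hg
  have hg0 : g 0 = 0 := by simp [hg]
  have e1 : (∑ k ∈ Icc 1 (2 * m),
      if IsSmallAt m α p t (kthLargest p t k) then 0 else kthLargest p t k) =
      ∑ k ∈ range (2 * m), g (l.getD k 0) := by
    rw [← Finset.Ico_add_one_right_eq_Icc, sum_Ico_eq_sum_range]
    apply sum_congr (by simp)
    intro k _
    simp only [kthLargest, hg, ← hl, Nat.add_sub_cancel_left]
  have e2 : ∑ k ∈ range (2 * m), g (l.getD k 0) =
      ∑ k ∈ range (max (2 * m) l.length), g (l.getD k 0) := by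
    apply sum_subset (by simp)
    intro k _ hk
    simp only [mem_range, not_lt] at hk
    have hle : l.getD k 0 ≤ kthLargest p t (2 * m + 1) := by
      have h0 := kthLargest_nonneg hp t (k + 1)
      have hkk : kthLargest p t (k + 1) = l.getD k 0 := rfl
      rw [← hkk]
      rcases h0.eq_or_lt with h0 | h0
      · rw [← h0]; exact kthLargest_nonneg hp _ _
      · rw [le_kthLargest_iff h0]
        exact hk.trans_lt ((le_kthLargest_iff h0 t k).1 le_rfl)
    have hL : 3 * kthLargest p t (2 * m + 1) ≤ lowerBound m p t := le_max_right _ _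
    have hsm : IsSmallAt m α p t (l.getD k 0) := by
      have := lowerBound_nonneg (m := m) hp t
      unfold IsSmallAt
      nlinarith
    simp only [hg]
    rw [if_pos hsm]
  rw [e1, e2, sum_range_getD hg0 _ _ (le_max_right _ _), ← Multiset.sum_coe, ← Multiset.map_coe,
    hl, Multiset.sort_eq, Multiset.map_map]
  rw [← filter_filter, sum_filter]
  apply sum_congr rfl
  intro i _
  simp only [hg, Function.comp_apply, ite_not]

open Classical in
lemma mul_smallAverage (hm : 0 < m) (hα : 4 / 3 ≤ α) (hp : ∀ i, 0 ≤ p i) (t : ℕ) :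
    m * smallAverage m α p t = ∑ i : Fin n with i.val < t ∧ IsSmallAt m α p t (p i), p i := by
  have hm0 : (m : ℝ) ≠ 0 := by exact_mod_cast hm.ne'
  unfold smallAverage
  rw [sum_large_kthLargest hα hp, ← mul_assoc, mul_one_div_cancel hm0, one_mul, prefixSum,
    ← filter_filter, ← filter_filter,
    ← sum_filter_add_sum_filter_not (univ.filter fun i : Fin n => i.val < t)
      (fun i => IsSmallAt m α p t (p i))]
  ring

lemma smallAverage_nonneg (hm : 0 < m) (hα : 4 / 3 ≤ α) (hp : ∀ i, 0 ≤ p i) (t : ℕ) :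
    0 ≤ smallAverage m α p t := by
  classical
  have hm0 : (0 : ℝ) < m := by exact_mod_cast hm
  have : (0 : ℝ) ≤ m * smallAverage m α p t := by
    rw [mul_smallAverage hm hα hp]
    exact sum_nonneg fun i _ => hp i
  exact nonneg_of_mul_nonneg_right this hm0

/-- L_t only grows, so small jobs stay small and the set of small jobs grows. -/
lemma smallAverage_mono (hm : 0 < m) (hα : 4 / 3 ≤ α) (hp : ∀ i, 0 ≤ p i) {t t' : ℕ}
    (h : t ≤ t') : smallAverage m α p t ≤ smallAverage m α p t' := by
  classical
  have hm0 : (0 : ℝ) < m := by exact_mod_cast hm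
  refine le_of_mul_le_mul_left ?_ hm0
  rw [mul_smallAverage hm hα hp, mul_smallAverage hm hα hp]
  apply sum_le_sum_of_subset_of_nonneg
  · intro i
    simp only [mem_filter, mem_univ, true_and]
    exact fun hi => ⟨hi.1.trans_le h, hi.2.mono (by linarith) hp h⟩
  · exact fun i _ _ => hp i

end Instance


/-! ### Lower bounds on the optimum. -/

section Instance

variable {n m : ℕ} {α : ℝ} {p : Fin n → ℝ}

lemma sum_le_makespan (p : Fin n → ℝ) (a : Fin n → Fin m) (j : Fin m) :
    ∑ i with a i = j, p i ≤ makespan p a :=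
  le_ciSup (f := fun j : Fin m => ∑ i with a i = j, p i) (Set.finite_range _).bddAbove j

lemma exists_makespan_eq_opt (hm : 0 < m) (p : Fin n → ℝ) :
    ∃ a : Fin n → Fin m, makespan p a = opt m p := by
  have : Nonempty (Fin m) := ⟨⟨0, hm⟩⟩
  exact exists_eq_ciInf_of_finite

lemma sum_le_opt_of_subset (hp : ∀ i, 0 ≤ p i) {a : Fin n → Fin m}
    (ha : makespan p a = opt m p) {S : Finset (Fin n)} {j : Fin m} (hS : ∀ i ∈ S, a i = j) :
    ∑ i ∈ S, p i ≤ opt m p := by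
  rw [← ha]
  refine le_trans (sum_le_sum_of_subset_of_nonneg ?_ fun i _ _ => hp i) (sum_le_makespan p a j)
  intro i hi
  simpa using hS i hi

lemma sum_le_mul_opt (hm : 0 < m) (p : Fin n → ℝ) : ∑ i, p i ≤ m * opt m p := by
  obtain ⟨a, ha⟩ := exists_makespan_eq_opt hm p
  rw [← sum_fiberwise univ a p, ← ha]
  calc ∑ j, ∑ i with a i = j, p i ≤ ∑ j : Fin m, makespan p a :=
        sum_le_sum fun j _ => sum_le_makespan p a j
    _ = _ := by simp

lemma le_opt (hm : 0 < m) (hp : ∀ i, 0 ≤ p i) (i : Fin n) : p i ≤ opt m p := by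
  obtain ⟨a, ha⟩ := exists_makespan_eq_opt hm p
  simpa using sum_le_opt_of_subset hp ha (S := {i}) (j := a i) (by simp)

lemma opt_nonneg (hm : 0 < m) (hp : ∀ i, 0 ≤ p i) : 0 ≤ opt m p := by
  obtain ⟨a, ha⟩ := exists_makespan_eq_opt hm p
  simpa using sum_le_opt_of_subset hp ha (S := ∅) (j := ⟨0, hm⟩) (by simp)

/-- If more than `2|T|` jobs, each of length at least `x`, are on the machines of `T` in an optimal
schedule, then three of them share a machine. -/
lemma three_mul_le_opt_of_card (hp : ∀ i, 0 ≤ p i) {a : Fin n → Fin m}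
    (ha : makespan p a = opt m p) {S : Finset (Fin n)} {T : Finset (Fin m)} {x : ℝ}
    (hST : ∀ i ∈ S, a i ∈ T) (hcard : 2 * #T < #S) (hx : ∀ i ∈ S, x ≤ p i) :
    3 * x ≤ opt m p := by
  obtain ⟨j, -, hj⟩ := exists_lt_card_fiber_of_mul_lt_card_of_maps_to hST
    (by rwa [mul_comm] at hcard : #T * 2 < #S)
  obtain ⟨U, hU, hUc⟩ := exists_subset_card_eq (show 3 ≤ #{i ∈ S | a i = j} by omega)
  calc 3 * x = ∑ i ∈ U, x := by simp [hUc]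
    _ ≤ ∑ i ∈ U, p i := sum_le_sum fun i hi => hx i (mem_filter.1 (hU hi)).1
    _ ≤ opt m p := sum_le_opt_of_subset hp ha (j := j) fun i hi => (mem_filter.1 (hU hi)).2

lemma three_mul_le_opt (hm : 0 < m) (hp : ∀ i, 0 ≤ p i) {S : Finset (Fin n)} {x : ℝ}
    (hcard : 2 * m < #S) (hx : ∀ i ∈ S, x ≤ p i) : 3 * x ≤ opt m p := by
  obtain ⟨a, ha⟩ := exists_makespan_eq_opt hm p
  exact three_mul_le_opt_of_card hp ha (T := univ) (fun i _ => mem_univ _) (by simpa using hcard) hx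

lemma lowerBound_le_opt (hm : 0 < m) (hp : ∀ i, 0 ≤ p i) : lowerBound m p n ≤ opt m p := by
  have hm0 : (0 : ℝ) < m := by exact_mod_cast hm
  apply max_le
  · rw [prefixSum_self, one_div, inv_mul_le_iff₀ hm0]
    exact sum_le_mul_opt hm p
  · rcases (kthLargest_nonneg hp n (2 * m + 1)).eq_or_lt with h0 | h0
    · rw [← h0, mul_zero]; exact opt_nonneg hm hp
    · exact three_mul_le_opt hm hp ((le_kthLargest_iff h0 n (2 * m)).1 le_rfl)
        fun i hi => (mem_filter.1 hi).2.2

/-- If all jobs of `A` have length at least `a`, all jobs of `B` have length at least `b ≤ a` and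
there are more than `2 (m - |A|)` jobs in `B`, then an optimal schedule combines a job of `A` with
another one, or three jobs of `B`. -/
lemma add_le_opt_or_three_mul_le_opt (hm : 0 < m) (hp : ∀ i, 0 ≤ p i) {A B : Finset (Fin n)}
    {x y : ℝ} (hyx : y ≤ x) (hAB : Disjoint A B) (hA : ∀ i ∈ A, x ≤ p i) (hB : ∀ i ∈ B, y ≤ p i)
    (hcard : 2 * m < 2 * #A + #B) : x + y ≤ opt m p ∨ 3 * y ≤ opt m p := by
  obtain ⟨s, hs⟩ := exists_makespan_eq_opt hm p
  -- Otherwise the jobs of A occupy |A| machines on which no other job of A ∪ B lies, and B is left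
  -- with m - |A| machines.
  by_cases h : ∃ i ∈ A, ∃ i' ∈ A ∪ B, i ≠ i' ∧ s i = s i'
  · left
    obtain ⟨i, hi, i', hi', hne, hss⟩ := h
    have h1 : y ≤ p i' := by
      rcases mem_union.1 hi' with h | h
      · exact hyx.trans (hA i' h)
      · exact hB i' h
    have := sum_le_opt_of_subset hp hs (S := {i, i'}) (j := s i) (by simp [hss])
    rw [sum_pair hne] at this
    linarith [hA i hi]
  · right
    push Not at h
    have hinj : #(A.image s) = #A := by
      apply card_image_of_injOn
      intro i hi i' hi' he
      by_contra hne
      exact h i hi i' (mem_union_left _ hi') hne he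
    refine three_mul_le_opt_of_card hp hs (S := B) (T := (A.image s)ᶜ) ?_ ?_ hB
    · intro i hi
      rw [mem_compl, mem_image]
      rintro ⟨i', hi', he⟩
      refine h i' hi' i (mem_union_right _ hi) ?_ he
      rintro rfl
      exact disjoint_left.1 hAB hi' hi
    · rw [card_compl, hinj, Fintype.card_fin]
      have : #A ≤ m := by
        rw [← hinj]; simpa using card_le_univ (A.image s)
      omega

/-- Take for A the k+1 longest jobs and for B the next 2m-1-2k, down to y. Then 2|A| + |B| = 2m+1,
just enough for the pigeonhole argument. -/
lemma pair_le_opt (hm : 0 < m) (hp : ∀ i, 0 ≤ p i) {r : List (Fin n)} (hr : r.Nodup)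
    (hs : r.Pairwise fun i i' => p i' ≤ p i) {k : ℕ} (hk : k < m) {x y : Fin n}
    (hx : r[k]? = some x) (hy : r[2 * m - 1 - k]? = some y) :
    p x + p y ≤ opt m p ∨ 3 * p y ≤ opt m p := by
  rw [List.getElem?_eq_some_iff] at hx hy
  obtain ⟨hk1, rfl⟩ := hx
  obtain ⟨hk2, rfl⟩ := hy
  have hmono : ∀ u v (hu : u < r.length) (hv : v < r.length), u ≤ v → p r[v] ≤ p r[u] := by
    intro u v hu hv huv
    rcases huv.eq_or_lt with rfl | huv
    · rfl
    · exact List.pairwise_iff_getElem.1 hs u v hu hv huv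
  set q : Fin r.length → Fin n := fun u => r[u] with hq
  have hqinj : Function.Injective q := fun u v huv => by
    have := hr.getElem_inj_iff.1 huv
    exact Fin.ext this
  have hc1 : #(univ.filter fun u : Fin r.length => u.val < k + 1) = k + 1 := by
    rw [Fin.card_filter_val_lt]; omega
  have hc2 : #(univ.filter fun u : Fin r.length => u.val < 2 * m - 1 - k + 1) =
      2 * m - 1 - k + 1 := by
    rw [Fin.card_filter_val_lt]; omega
  have hsub : (univ.filter fun u : Fin r.length => u.val < k + 1) ⊆
      (univ.filter fun u : Fin r.length => u.val < 2 * m - 1 - k + 1) := by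
    intro u
    simp only [mem_filter, mem_univ, true_and]
    omega
  refine add_le_opt_or_three_mul_le_opt hm hp
    (A := (univ.filter fun u : Fin r.length => u.val < k + 1).image q)
    (B := ((univ.filter fun u : Fin r.length => u.val < 2 * m - 1 - k + 1) \
      (univ.filter fun u : Fin r.length => u.val < k + 1)).image q)
    (hmono _ _ _ _ (by omega)) ?_ ?_ ?_ ?_
  · rw [disjoint_image hqinj]
    exact disjoint_sdiff
  · intro i hi
    simp only [mem_image, mem_filter, mem_univ, true_and] at hi
    obtain ⟨u, hu, rfl⟩ := hi
    exact hmono _ _ _ _ (by omega)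
  · intro i hi
    simp only [mem_image, mem_sdiff, mem_filter, mem_univ, true_and] at hi
    obtain ⟨u, hu, rfl⟩ := hi
    exact hmono _ _ _ _ (by omega)
  · rw [card_image_of_injective _ hqinj, card_image_of_injective _ hqinj,
      card_sdiff_of_subset hsub, hc1, hc2]
    omega

end Instance


/-! ### Optimality of greedy removal. -/

/-- Among two sets of which the first has at most as many elements, and whose elements weigh at
most as much as those of the second that are not shared, the first weighs at most as much. -/
lemma sum_le_sum_of_card_le_of_dominated {ι : Type*} [DecidableEq ι] {p : ι → ℝ} {D R : Finset ι}
    (hp : ∀ i, 0 ≤ p i) (hcard : #D ≤ #R) (h : ∀ y ∈ D, y ∉ R → ∀ x ∈ R, p y ≤ p x) :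
    ∑ i ∈ D, p i ≤ ∑ i ∈ R, p i := by
  have hc : #(D \ R) ≤ #(R \ D) := by
    have h1 := card_sdiff_add_card_inter D R
    have h2 := card_sdiff_add_card_inter R D
    rw [inter_comm] at h2
    omega
  have key : ∑ i ∈ D \ R, p i ≤ ∑ i ∈ R \ D, p i := by
    rcases (R \ D).eq_empty_or_nonempty with he | hne
    · have : D \ R = ∅ := by rw [he, card_empty] at hc; exact card_eq_zero.1 (by omega)
      rw [he, this]
    · obtain ⟨x, hx, hmin⟩ := exists_min_image (R \ D) p hne
      calc ∑ i ∈ D \ R, p i ≤ #(D \ R) • p x := sum_le_card_nsmul _ _ _ fun y hy =>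
            h y (mem_sdiff.1 hy).1 (mem_sdiff.1 hy).2 x (mem_sdiff.1 hx).1
        _ ≤ #(R \ D) • p x := by
            rw [nsmul_eq_mul, nsmul_eq_mul]
            exact mul_le_mul_of_nonneg_right (by exact_mod_cast hc) (hp x)
        _ ≤ _ := card_nsmul_le_sum _ _ _ hmin
  have h1 := sum_inter_add_sum_sdiff D R p
  have h2 := sum_inter_add_sum_sdiff R D p
  rw [inter_comm] at h2
  linarith

/-- Removing largest elements first is optimal for bringing a total weight down to `T`. -/
lemma card_le_card_of_greedy {ι : Type*} [DecidableEq ι] {p : ι → ℝ} (hp : ∀ i, 0 ≤ p i)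
    {J R D : Finset ι} {T : ℝ} (hR : R ⊆ J) (hD : D ⊆ J) (hdom : ∀ x ∈ R, ∀ y ∈ J \ R, p y ≤ p x)
    {i : ι} (hi : i ∈ R) (hmin : ∀ x ∈ R, p i ≤ p x) (hT : T < ∑ y ∈ J \ R, p y + p i)
    (hDT : ∑ y ∈ J \ D, p y ≤ T) : #R ≤ #D := by
  by_contra! hlt
  -- If D were smaller than R, it would weigh no more than R without its lightest element i. But
  -- removing only those elements leaves more than T.
  have hcard : #D ≤ #(R.erase i) := by rw [card_erase_of_mem hi]; omega
  have := sum_le_sum_of_card_le_of_dominated hp hcard (fun y hy hyR x hx => by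
    have hxR := mem_of_mem_erase hx
    by_cases hyi : y = i
    · rw [hyi]; exact hmin x hxR
    · exact hdom x hxR y (mem_sdiff.2 ⟨hD hy, fun h => hyR (mem_erase.2 ⟨hyi, h⟩)⟩))
  have h1 := sum_sdiff (f := p) hR
  have h2 := sum_sdiff (f := p) hD
  have h3 := sum_erase_add R p hi
  linarith

/-! ### How few removals suffice on one machine. -/

section Instance

variable {n m : ℕ} {α : ℝ} {p : Fin n → ℝ}

open Classical in
/-- What is known about a schedule `s` that the arrival phase has built for the first `t` jobs. -/
structure ArrivalInvariant (α : ℝ) (p : Fin n → ℝ) (t : ℕ) (s : Sched n m) : Prop where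
  assigned : ∀ i, s i = none ↔ t ≤ i.val
  small : ∀ i j, s i = some j → IsSmallAt m α p (i.val + 1) (p i) →
    ∑ i' with i' < i ∧ s i' = some j ∧ IsSmallAt m α p (i.val + 1) (p i'), p i' ≤
      beta α j * smallAverage m α p (i.val + 1)
  large : ∀ i j, s i = some j → ¬ IsSmallAt m α p (i.val + 1) (p i) →
    ∑ i' with i' < i ∧ s i' = some j, p i' ≤ lowerBound m p (i.val + 1)

/-- A set of load at most `Λ` drops to load `(α - 1) Λ` when `⌈(2 - α) / (α - 1)²⌉` elements of
length at least `(α - 1)² Λ` are taken away. -/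
lemma exists_shed {Λ : ℝ} (hΛ : 0 ≤ Λ) (hα : 1 < α) {X K : Finset (Fin n)} (hKX : K ⊆ X)
    (hX : ∑ i ∈ X, p i ≤ Λ) (hK : ∀ i ∈ K, (α - 1) ^ 2 * Λ ≤ p i) :
    #K < ⌈(2 - α) / (α - 1) ^ 2⌉₊ ∨
      ∃ D ⊆ K, #D = ⌈(2 - α) / (α - 1) ^ 2⌉₊ ∧ ∑ i ∈ X \ D, p i ≤ (α - 1) * Λ := by
  rcases lt_or_ge #K ⌈(2 - α) / (α - 1) ^ 2⌉₊ with h | h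
  · exact Or.inl h
  · right
    obtain ⟨D, hDK, hDc⟩ := exists_subset_card_eq h
    refine ⟨D, hDK, hDc, ?_⟩
    have h1 : #D • ((α - 1) ^ 2 * Λ) ≤ ∑ i ∈ D, p i :=
      card_nsmul_le_sum _ _ _ fun i hi => hK i (hDK hi)
    have hpos : 0 < (α - 1) ^ 2 := by have : 0 < α - 1 := by linarith
                                      positivity
    have h2 : (2 - α) ≤ (#D : ℝ) * (α - 1) ^ 2 := by
      rw [hDc, ← div_le_iff₀ hpos]; exact Nat.le_ceil _
    have h3 := sum_sdiff (f := p) (hDK.trans hKX)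
    rw [nsmul_eq_mul] at h1
    nlinarith

/-- If the jobs of an upward closed set `Q` of jobs on `M_j` were all assigned to a least loaded
machine and have length at least `(α - 1)² L`, and the other jobs can be brought down to load `T` by
removing the at most four jobs of `E`, then all jobs of `M_j` can be brought down to load `T` by
`⌈(2 - α) / (α - 1)²⌉ + 4` removals. -/
lemma exists_removals_of_tail (hp : ∀ i, 0 ≤ p i) (hα : 1 < α) {s : Sched n m}
    (hs : ArrivalInvariant α p n s) {j : Fin m} {T : ℝ} (hT : (α - 1) * lowerBound m p n ≤ T)
    {J Q E : Finset (Fin n)} (hJ : ∀ i, i ∈ J ↔ s i = some j) (hQJ : Q ⊆ J)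
    (hQ : ∀ i ∈ Q, ¬ IsSmallAt m α p (i.val + 1) (p i))
    (hQp : ∀ i ∈ Q, (α - 1) ^ 2 * lowerBound m p n ≤ p i)
    (hup : ∀ i ∈ Q, ∀ i' ∈ J, i < i' → i' ∈ Q) (hE : #E ≤ 4) (hEJ : E ⊆ J)
    (hET : ∑ i ∈ (J \ Q) \ E, p i ≤ T) :
    ∃ D ⊆ J, #D ≤ ⌈(2 - α) / (α - 1) ^ 2⌉₊ + 4 ∧ ∑ i ∈ J \ D, p i ≤ T := by
  rcases Q.eq_empty_or_nonempty with rfl | hne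
  · exact ⟨E, hEJ, by omega, by simpa using hET⟩
  · set z := Q.max' hne with hz
    have hzQ : z ∈ Q := max'_mem _ _
    have hXeq : J.erase z = univ.filter fun i => i < z ∧ s i = some j := by
      ext i
      simp only [mem_erase, mem_filter, mem_univ, true_and, hJ]
      refine ⟨fun ⟨h1, h2⟩ => ⟨?_, h2⟩, fun ⟨h1, h2⟩ => ⟨h1.ne, h2⟩⟩
      rcases lt_trichotomy i z with h | h | h
      · exact h
      · exact absurd h h1
      · exact absurd (le_max' Q i (hup z hzQ i ((hJ i).2 h2) h)) (not_le.2 h)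
    have hX : ∑ i ∈ J.erase z, p i ≤ lowerBound m p n := by
      rw [hXeq]
      exact (hs.large z j ((hJ z).1 (hQJ hzQ)) (hQ z hzQ)).trans (lowerBound_mono hp z.2)
    rcases exists_shed (lowerBound_nonneg hp n) hα (erase_subset_erase z hQJ) hX
      (fun i hi => hQp i (mem_of_mem_erase hi)) with h | ⟨D, hD, hDc, hDs⟩
    · rw [card_erase_of_mem hzQ] at h
      have hpos := card_pos.2 hne
      refine ⟨Q ∪ E, union_subset hQJ hEJ, ?_, ?_⟩
      · have := card_union_le Q E
        omega
      · rwa [← sup_eq_union, ← sdiff_sdiff_left]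
    · refine ⟨insert z D, ?_, ?_, ?_⟩
      · exact insert_subset (hQJ hzQ) (hD.trans ((erase_subset _ _).trans hQJ))
      · have := card_insert_le z D
        omega
      · rw [sdiff_insert, ← erase_sdiff_comm]
        exact hDs.trans hT

/-- A job large on arrival has length at least (α-1)²L as soon as L_t > (α-1)L. Let C hold the jobs
that come after all jobs small on arrival, are themselves large on arrival, and arrived with L_t ≤
(α-1)L. If C has a last job a, the load before a is at most (α-1)L, so E = {a} works and the tail Q
starts after a. If C is empty, Q starts after the last job l that was small on arrival. Before l,
the jobs small at l's arrival weigh at most β(j)L*, and at most three others precede l; these and l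
form E. -/
lemma exists_removals (hα : 4 / 3 ≤ α) (hm : 0 < m) (hp : ∀ i, 0 ≤ p i) {s : Sched n m}
    (hs : ArrivalInvariant α p n s) (j : Fin m) {J : Finset (Fin n)}
    (hJ : ∀ i, i ∈ J ↔ s i = some j) :
    ∃ D ⊆ J, #D ≤ ⌈(2 - α) / (α - 1) ^ 2⌉₊ + 4 ∧ ∑ i ∈ J \ D, p i ≤
      max (beta α j * smallAverage m α p n) ((α - 1) * lowerBound m p n) := by
  classical
  have hα1 : 1 < α := by linarith
  have hx : 0 < α - 1 := by linarith
  set Λ := lowerBound m p n with hΛ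
  set T := max (beta α j * smallAverage m α p n) ((α - 1) * Λ) with hT
  have hTΛ : (α - 1) * Λ ≤ T := le_max_right _ _
  have hlen : ∀ i, ¬ IsSmallAt m α p (i.val + 1) (p i) →
      (α - 1) * Λ < lowerBound m p (i.val + 1) → (α - 1) ^ 2 * Λ ≤ p i := by
    intro i hi hL
    unfold IsSmallAt at hi
    nlinarith
  set C := J.filter fun a => ¬ IsSmallAt m α p (a.val + 1) (p a) ∧
    lowerBound m p (a.val + 1) ≤ (α - 1) * Λ ∧
    ∀ i ∈ J, IsSmallAt m α p (i.val + 1) (p i) → i < a with hC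
  rcases C.eq_empty_or_nonempty with hCe | hCne
  · have hnoC : ∀ a ∈ J, ¬ IsSmallAt m α p (a.val + 1) (p a) →
        (∀ i ∈ J, IsSmallAt m α p (i.val + 1) (p i) → i < a) →
        (α - 1) ^ 2 * Λ ≤ p a := by
      intro a ha hbig hlast
      apply hlen a hbig
      by_contra! hle
      have : a ∈ C := by rw [hC, mem_filter]; exact ⟨ha, hbig, hle, hlast⟩
      rw [hCe] at this
      simp at this
    set S := J.filter fun i => IsSmallAt m α p (i.val + 1) (p i) with hS
    rcases S.eq_empty_or_nonempty with hSe | hSne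
    · have hnoS : ∀ i ∈ J, ¬ IsSmallAt m α p (i.val + 1) (p i) := by
        intro i hi hsm
        have : i ∈ S := by rw [hS, mem_filter]; exact ⟨hi, hsm⟩
        rw [hSe] at this
        simp at this
      refine exists_removals_of_tail hp hα1 hs hTΛ hJ (Q := J) (E := ∅) subset_rfl hnoS ?_ ?_ ?_ ?_ ?_
      · exact fun i hi => hnoC i hi (hnoS i hi) fun i' hi' h => absurd h (hnoS i' hi')
      · exact fun _ _ i' hi' _ => hi'
      · simp
      · simp
      · simpa using (mul_nonneg hx.le (lowerBound_nonneg hp n)).trans hTΛ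
    · set l := S.max' hSne with hl
      have hlS : l ∈ S := max'_mem _ _
      obtain ⟨hlJ, hlsm⟩ := mem_filter.1 hlS
      have hafter : ∀ i ∈ J, l < i → ∀ i' ∈ J, IsSmallAt m α p (i'.val + 1) (p i') → i' < i :=
        fun i _ hli i' hi' h => (le_max' S i' (mem_filter.2 ⟨hi', h⟩)).trans_lt hli
      have hbig : ∀ i ∈ J, l < i → ¬ IsSmallAt m α p (i.val + 1) (p i) :=
        fun i hi hli h => lt_irrefl _ (hafter i hi hli i hi h)
      set K := J.filter fun i => i < l ∧ ¬ IsSmallAt m α p (l.val + 1) (p i) with hK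
      have hKbig : ∀ i ∈ K, ¬ IsSmallAt m α p (i.val + 1) (p i) := by
        intro i hi h
        obtain ⟨-, hil, hns⟩ := mem_filter.1 hi
        exact hns (h.mono hα1 hp (by have : i.val < l.val := hil
                                     omega))
      -- The last job of K went to a least loaded machine, so the others total at most Y. Each of
      -- them exceeds (α-1)Y ≥ Y/3, hence there are at most two.
      have hKcard : #K ≤ 3 := by
        by_contra! h4
        have hKne : K.Nonempty := card_pos.1 (by omega)
        set z := K.max' hKne with hz
        have hzK : z ∈ K := max'_mem _ _
        obtain ⟨hzJ, hzl, -⟩ := mem_filter.1 hzK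
        set Y := lowerBound m p (l.val + 1) with hY
        have h1 : ∑ i ∈ K.erase z, p i ≤ Y := by
          refine le_trans (sum_le_sum_of_subset_of_nonneg ?_ fun i _ _ => hp i)
            ((hs.large z j ((hJ z).1 hzJ) (hKbig z hzK)).trans (lowerBound_mono hp (by
              have : z.val < l.val := hzl
              omega)))
          intro i hi
          rw [mem_erase] at hi
          simp only [mem_filter, mem_univ, true_and]
          exact ⟨lt_of_le_of_ne (le_max' _ _ hi.2) hi.1, (hJ i).1 (mem_filter.1 hi.2).1⟩
        have hc : 3 ≤ #(K.erase z) := by rw [card_erase_of_mem hzK]; omega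
        obtain ⟨U, hU, hUc⟩ := exists_subset_card_eq hc
        have h2 : ∑ i ∈ U, p i ≤ ∑ i ∈ K.erase z, p i :=
          sum_le_sum_of_subset_of_nonneg hU fun i _ _ => hp i
        have h3 : ∑ i ∈ U, (α - 1) * Y < ∑ i ∈ U, p i := by
          apply sum_lt_sum_of_nonempty (card_pos.1 (by omega))
          intro i hi
          have := (mem_filter.1 (mem_of_mem_erase (hU hi))).2.2
          exact not_le.1 this
        have h4 : 0 ≤ Y := lowerBound_nonneg hp _
        rw [sum_const, hUc, nsmul_eq_mul] at h3
        push_cast at h3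
        nlinarith
      refine exists_removals_of_tail hp hα1 hs hTΛ hJ (Q := J.filter (l < ·)) (E := insert l K)
        (filter_subset _ _) ?_ ?_ ?_ ?_ ?_ ?_
      · exact fun i hi => hbig i (mem_filter.1 hi).1 (mem_filter.1 hi).2
      · intro i hi
        obtain ⟨h1, h2⟩ := mem_filter.1 hi
        exact hnoC i h1 (hbig i h1 h2) (hafter i h1 h2)
      · exact fun i hi i' hi' hlt => mem_filter.2 ⟨hi', (mem_filter.1 hi).2.trans hlt⟩
      · have := card_insert_le l K
        omega
      · exact insert_subset hlJ (filter_subset _ _)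
      · have hsub : (J \ J.filter (l < ·)) \ insert l K ⊆ univ.filter fun i' => i' < l ∧
            s i' = some j ∧ IsSmallAt m α p (l.val + 1) (p i') := by
          intro i hi
          simp only [hK, mem_sdiff, mem_filter, mem_insert, not_and, not_or, not_lt] at hi
          obtain ⟨⟨hiJ, h1⟩, h2, h3⟩ := hi
          have hlt : i < l := lt_of_le_of_ne (h1 hiJ) h2
          simp only [mem_filter, mem_univ, true_and]
          exact ⟨hlt, (hJ i).1 hiJ, not_not.1 (h3 hiJ hlt)⟩
        refine (sum_le_sum_of_subset_of_nonneg hsub fun i _ _ => hp i).trans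
          ((hs.small l j ((hJ l).1 hlJ) hlsm).trans (le_trans ?_ (le_max_left _ _)))
        apply mul_le_mul_of_nonneg_left (smallAverage_mono hm hα hp l.2)
        rw [beta_eq_weight hα1]
        exact weight_nonneg hα1
  · set a := C.max' hCne with ha
    have haC : a ∈ C := max'_mem _ _
    obtain ⟨haJ, habig, haL, halast⟩ := mem_filter.1 haC
    have hbig : ∀ i ∈ J, a < i → ¬ IsSmallAt m α p (i.val + 1) (p i) :=
      fun i hi hai h => lt_asymm hai (halast i hi h)
    refine exists_removals_of_tail hp hα1 hs hTΛ hJ (Q := J.filter (a < ·)) (E := {a})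
      (filter_subset _ _) ?_ ?_ ?_ ?_ ?_ ?_
    · exact fun i hi => hbig i (mem_filter.1 hi).1 (mem_filter.1 hi).2
    · intro i hi
      obtain ⟨h1, h2⟩ := mem_filter.1 hi
      apply hlen i (hbig i h1 h2)
      by_contra! hle
      have : i ∈ C := mem_filter.2 ⟨h1, hbig i h1 h2, hle,
        fun i' hi' h => (halast i' hi' h).trans h2⟩
      exact absurd (le_max' C i this) (not_le.2 h2)
    · exact fun i hi i' hi' hlt => mem_filter.2 ⟨hi', (mem_filter.1 hi).2.trans hlt⟩
    · simp
    · simpa using haJ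
    · refine le_trans (sum_le_sum_of_subset_of_nonneg ?_ fun i _ _ => hp i)
        ((hs.large a j ((hJ a).1 haJ) habig).trans (haL.trans hTΛ))
      intro i hi
      simp only [mem_sdiff, mem_filter, mem_singleton, not_and, not_lt] at hi
      simp only [mem_filter, mem_univ, true_and]
      exact ⟨lt_of_le_of_ne (hi.1.2 hi.1.1) hi.2, (hJ i).1 hi.1.1⟩

end Instance


/-! ### The arrival phase. -/

section Instance

variable {n m : ℕ} {α : ℝ} {p : Fin n → ℝ}

lemma sum_load (p : Fin n → ℝ) (s : Sched n m) :
    ∑ j, load p s j = ∑ i with s i ≠ none, p i := by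
  classical
  unfold load
  rw [← sum_biUnion]
  · apply sum_congr _ fun _ _ => rfl
    ext i
    simp [← Option.isSome_iff_ne_none, Option.isSome_iff_exists]
  · intro j _ j' _ hne
    rw [Function.onFun, disjoint_filter]
    intro i _ h h'
    exact hne (Option.some.inj (h.symm.trans h'))

lemma IsLeastLoaded.mul_load_le {s : Sched n m} {j : Fin m} (h : IsLeastLoaded p s j) :
    m * load p s j ≤ ∑ i with s i ≠ none, p i := by
  rw [← sum_load]
  calc m * load p s j = ∑ _j' : Fin m, load p s j := by simp
    _ ≤ _ := sum_le_sum fun j' _ => h j'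

lemma exists_isLeastLoaded (hm : 0 < m) (p : Fin n → ℝ) (s : Sched n m) :
    ∃ j, IsLeastLoaded p s j := by
  have : Nonempty (Fin m) := ⟨⟨0, hm⟩⟩
  obtain ⟨j, -, hj⟩ := exists_min_image univ (load p s) univ_nonempty
  exact ⟨j, fun j' => hj j' (mem_univ _)⟩

lemma place_singleton_eq_some {t i : Fin n} {s : Sched n m} {j j' : Fin m} :
    place s {t} j i = some j' ↔ (i = t ∧ j = j') ∨ (i ≠ t ∧ s i = some j') := by
  unfold place
  by_cases h : i = t <;> simp [h]

lemma ArrivalInvariant.init (α : ℝ) (p : Fin n → ℝ) :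
    ArrivalInvariant (m := m) α p 0 fun _ => none :=
  ⟨by simp, by simp, by simp⟩

lemma ArrivalInvariant.assigned_place {t : Fin n} {s : Sched n m}
    (hs : ArrivalInvariant α p t.val s) (j : Fin m) (i : Fin n) :
    place s {t} j i = none ↔ t.val + 1 ≤ i.val := by
  have := hs.assigned i
  unfold place
  by_cases h : i = t
  · simp [h]
  · have h' : i.val ≠ t.val := fun e => h (Fin.ext e)
    simp only [mem_singleton, h, if_false, this]
    omega

lemma ArrivalInvariant.lt_of_eq_some {t : ℕ} {s : Sched n m} (hs : ArrivalInvariant α p t s)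
    {i : Fin n} {j : Fin m} (h : s i = some j) : i.val < t := by
  by_contra! h'
  rw [(hs.assigned i).2 h'] at h
  cases h

lemma ArrivalInvariant.place_prefix {t : Fin n} {s : Sched n m} {j j' : Fin m} {i i' : Fin n}
    (hi : i ≤ t) (h : i' < i) : place s {t} j i' = some j' ↔ s i' = some j' := by
  rw [place_singleton_eq_some]
  have : i' ≠ t := (h.trans_le hi).ne
  simp [this]

lemma ArrivalInvariant.place {t : Fin n} {s : Sched n m} (hs : ArrivalInvariant α p t.val s)
    (j : Fin m)
    (hsm : IsSmallAt m α p (t.val + 1) (p t) →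
      smallLoad α p (t.val + 1) s j ≤ beta α j * smallAverage m α p (t.val + 1))
    (hlg : ¬ IsSmallAt m α p (t.val + 1) (p t) → load p s j ≤ lowerBound m p (t.val + 1)) :
    ArrivalInvariant α p (t.val + 1) (place s {t} j) := by
  classical
  have hlt : ∀ {i j'}, s i = some j' → i < t := fun h => hs.lt_of_eq_some h
  refine ⟨hs.assigned_place j, ?_, ?_⟩
  · intro i j' h hsmall
    rcases place_singleton_eq_some.1 h with ⟨rfl, rfl⟩ | ⟨-, h⟩
    · refine le_trans (le_of_eq ?_) (hsm hsmall)
      unfold smallLoad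
      apply sum_congr _ fun _ _ => rfl
      ext i'
      simp only [mem_filter, mem_univ, true_and]
      refine ⟨fun ⟨h1, h2, h3⟩ => ⟨(place_prefix le_rfl h1).1 h2, h3⟩, fun ⟨h2, h3⟩ => ?_⟩
      exact ⟨hlt h2, (place_prefix le_rfl (hlt h2)).2 h2, h3⟩
    · refine le_trans (le_of_eq ?_) (hs.small i j' h hsmall)
      apply sum_congr _ fun _ _ => rfl
      ext i'
      simp only [mem_filter, mem_univ, true_and]
      exact and_congr_right fun h1 => by rw [place_prefix (hlt h).le h1]
  · intro i j' h hlarge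
    rcases place_singleton_eq_some.1 h with ⟨rfl, rfl⟩ | ⟨-, h⟩
    · refine le_trans (le_of_eq ?_) (hlg hlarge)
      unfold load
      apply sum_congr _ fun _ _ => rfl
      ext i'
      simp only [mem_filter, mem_univ, true_and]
      refine ⟨fun ⟨h1, h2⟩ => (place_prefix le_rfl h1).1 h2, fun h2 => ?_⟩
      exact ⟨hlt h2, (place_prefix le_rfl (hlt h2)).2 h2⟩
    · refine le_trans (le_of_eq ?_) (hs.large i j' h hlarge)
      apply sum_congr _ fun _ _ => rfl
      ext i'
      simp only [mem_filter, mem_univ, true_and]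
      exact and_congr_right fun h1 => by rw [place_prefix (hlt h).le h1]

lemma ArrivalInvariant.load_le_lowerBound (hm : 0 < m) (hp : ∀ i, 0 ≤ p i) {t : ℕ}
    {s : Sched n m} (hs : ArrivalInvariant α p t s) {j : Fin m} (hj : IsLeastLoaded p s j) :
    load p s j ≤ lowerBound m p (t + 1) := by
  have hm0 : (0 : ℝ) < m := by exact_mod_cast hm
  refine le_of_mul_le_mul_left ?_ hm0
  calc m * load p s j ≤ ∑ i with s i ≠ none, p i := hj.mul_load_le
    _ = prefixSum p t := by
        apply sum_congr _ fun _ _ => rfl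
        ext i
        simp [hs.assigned i]
    _ ≤ m * lowerBound m p t := prefixSum_le_mul_lowerBound hm t
    _ ≤ _ := mul_le_mul_of_nonneg_left (lowerBound_mono hp (Nat.le_succ t)) hm0.le

/-- In the arrival phase there is a machine for every small job. -/
lemma ArrivalInvariant.exists_machine (hm : 2 ≤ m) (hα : 4 / 3 ≤ α) (hf : f m α = 1)
    (hp : ∀ i, 0 ≤ p i) {t : ℕ} {s : Sched n m} (hs : ArrivalInvariant α p t s) :
    ∃ j, smallLoad α p (t + 1) s j ≤ beta α j * smallAverage m α p (t + 1) := by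
  classical
  have h : ∑ j, smallLoad α p (t + 1) s j ≤
      ∑ j : Fin m, beta α j * smallAverage m α p (t + 1) := by
    rw [← sum_mul, sum_beta hm (by linarith), hf, mul_one, mul_smallAverage (by omega) hα hp]
    unfold smallLoad
    rw [← sum_biUnion]
    · apply sum_le_sum_of_subset_of_nonneg _ fun i _ _ => hp i
      intro i
      simp only [mem_biUnion, mem_univ, true_and, mem_filter, forall_exists_index, and_imp]
      intro j hj hsm
      exact ⟨(hs.lt_of_eq_some hj).trans (Nat.lt_succ_self t), hsm⟩
    · intro j _ j' _ hne
      rw [Function.onFun, disjoint_filter]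
      intro i _ h h'
      exact hne (Option.some.inj (h.1.symm.trans h'.1))
  have hne : (univ : Finset (Fin m)).Nonempty := ⟨⟨0, by omega⟩, mem_univ _⟩
  obtain ⟨j, -, hj⟩ := exists_le_of_sum_le hne h
  exact ⟨j, hj⟩

/-! ### The removal step. -/

/-- The load down to which the removal step unloads machine `M_j`. -/
noncomputable def threshold (α : ℝ) (p : Fin n → ℝ) (j : Fin m) : ℝ :=
  max (beta α j * smallAverage m α p n) ((α - 1) * lowerBound m p n)

/-- What is known in the removal step: the removed jobs of each machine are the longest ones, and
before the last removal the machine was overloaded. -/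
structure RemovalInvariant (α : ℝ) (p : Fin n → ℝ) (s₀ s : Sched n m) (R : Finset (Fin n)) :
    Prop where
  arrival : ArrivalInvariant α p n s₀
  removed : ∀ i ∈ R, s i = none
  kept : ∀ i ∉ R, s i = s₀ i
  longest : ∀ i ∈ R, ∀ i' ∉ R, s₀ i' = s₀ i → p i' ≤ p i
  overloaded : ∀ j, (∃ i ∈ R, s₀ i = some j) → ∃ i ∈ R, s₀ i = some j ∧
    (∀ i' ∈ R, s₀ i' = some j → p i ≤ p i') ∧ threshold α p j < load p s j + p i

lemma RemovalInvariant.eq_none_iff {s₀ s : Sched n m} {R : Finset (Fin n)}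
    (h : RemovalInvariant α p s₀ s R) (i : Fin n) : s i = none ↔ i ∈ R := by
  refine ⟨fun hi => ?_, h.removed i⟩
  by_contra hR
  rw [h.kept i hR, h.arrival.assigned] at hi
  exact absurd i.2 (by omega)

lemma RemovalInvariant.start {s : Sched n m} (h : ArrivalInvariant α p n s) :
    RemovalInvariant α p s s ∅ :=
  ⟨h, by simp, by simp, by simp, by simp⟩

lemma RemovalInvariant.remove {s₀ s : Sched n m} {R : Finset (Fin n)}
    (h : RemovalInvariant α p s₀ s R) {j : Fin m} {i : Fin n} (hj : Overloaded α p s j)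
    (hi : s i = some j) (hmax : ∀ i', s i' = some j → p i' ≤ p i) :
    RemovalInvariant α p s₀ (Function.update s i none) (insert i R) := by
  have hiR : i ∉ R := fun hR => by rw [h.removed i hR] at hi; cases hi
  have hi₀ : s₀ i = some j := by rw [← h.kept i hiR, hi]
  refine ⟨h.arrival, ?_, ?_, ?_, ?_⟩
  · intro x hx
    by_cases hxi : x = i
    · simp [hxi]
    · rw [Function.update_of_ne hxi]
      exact h.removed x (mem_of_mem_insert_of_ne hx hxi)
  · intro x hx
    rw [mem_insert, not_or] at hx
    rw [Function.update_of_ne hx.1]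
    exact h.kept x hx.2
  · intro x hx y hy hxy
    rw [mem_insert, not_or] at hy
    rcases mem_insert.1 hx with rfl | hx
    · apply hmax
      rw [h.kept y hy.2, hxy, hi₀]
    · exact h.longest x hx y hy.2 hxy
  · intro k hk
    by_cases hkj : k = j
    · subst hkj
      -- The newest removal is the shortest from its machine, because it was still present when the
      -- earlier ones were chosen as longest.
      refine ⟨i, mem_insert_self _ _, hi₀, ?_, ?_⟩
      · intro x hx hxk
        rcases mem_insert.1 hx with rfl | hx
        · exact le_rfl
        · exact h.longest x hx i hiR (hi₀.trans hxk.symm)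
      · have : load p (Function.update s i none) k + p i = load p s k := by
          unfold load
          have e : (univ.filter fun x => Function.update s i none x = some k) =
              (univ.filter fun x => s x = some k).erase i := by
            ext x
            by_cases hxi : x = i <;> simp [hxi]
          rw [e, sum_erase_add _ _ (by simpa using hi)]
        rw [this]
        exact hj
    · obtain ⟨x, hx, hxk⟩ := hk
      have hxi : x ≠ i := by
        rintro rfl
        exact hkj (Option.some.inj (hxk.symm.trans hi₀))
      obtain ⟨y, hy, hyk, hmin, hload⟩ :=
        h.overloaded k ⟨x, mem_of_mem_insert_of_ne hx hxi, hxk⟩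
      refine ⟨y, mem_insert_of_mem hy, hyk, ?_, ?_⟩
      · intro z hz hzk
        rcases mem_insert.1 hz with rfl | hz
        · exact absurd (Option.some.inj (hzk.symm.trans hi₀)) hkj
        · exact hmin z hz hzk
      · convert hload using 2
        unfold load
        apply sum_congr _ fun _ _ => rfl
        ext z
        by_cases hzi : z = i
        · subst hzi
          simp [hi, Ne.symm hkj]
        · simp [hzi]

/-- On each machine the jobs removed so far form a greedy set, still insufficient without its
shortest member, so they are no more numerous than the set from `exists_removals`. -/
lemma RemovalInvariant.card_le (hα : 4 / 3 ≤ α) (hm : 0 < m) (hp : ∀ i, 0 ≤ p i)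
    {s₀ s : Sched n m} {R : Finset (Fin n)} (h : RemovalInvariant α p s₀ s R) :
    #R ≤ (⌈(2 - α) / (α - 1) ^ 2⌉₊ + 4) * m := by
  classical
  have hfib : ∀ j : Fin m, #{i ∈ R | s₀ i = some j} ≤ ⌈(2 - α) / (α - 1) ^ 2⌉₊ + 4 := by
    intro j
    rcases ({i ∈ R | s₀ i = some j} : Finset (Fin n)).eq_empty_or_nonempty with he | ⟨x, hx⟩
    · rw [he]; simp
    · rw [mem_filter] at hx
      obtain ⟨i, hi, hij, hmin, hload⟩ := h.overloaded j ⟨x, hx⟩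
      obtain ⟨D, hDJ, hDc, hDT⟩ := exists_removals hα hm hp h.arrival j
        (J := univ.filter fun i => s₀ i = some j) (by simp)
      refine le_trans (card_le_card_of_greedy (J := univ.filter fun i => s₀ i = some j) hp
        ?_ hDJ ?_ (i := i) ?_ ?_ ?_ hDT) hDc
      · intro y
        simp only [mem_filter, mem_univ, true_and]
        exact fun hy => hy.2
      · intro y hy z hz
        simp only [mem_filter, mem_sdiff, mem_univ, true_and, not_and] at hy hz
        exact h.longest y hy.1 z (fun hzR => hz.2 hzR hz.1) (hz.1.trans hy.2.symm)
      · exact mem_filter.2 ⟨hi, hij⟩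
      · intro y hy
        rw [mem_filter] at hy
        exact hmin y hy.1 hy.2
      · refine hload.trans_eq (congrArg (· + p i) (Eq.symm ?_))
        unfold load
        apply sum_congr _ fun _ _ => rfl
        ext z
        simp only [mem_sdiff, mem_filter, mem_univ, true_and, not_and]
        constructor
        · rintro ⟨h1, h2⟩
          rw [h.kept z fun hzR => h2 hzR h1, h1]
        · intro hz
          have hzR : z ∉ R := fun hzR => by rw [h.removed z hzR] at hz; cases hz
          exact ⟨by rw [← h.kept z hzR, hz], fun h' => absurd h' hzR⟩
  have hmaps : ∀ i ∈ R, s₀ i ∈ (univ.image (some : Fin m → Option (Fin m))) := by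
    intro i _
    rw [mem_image]
    cases hsi : s₀ i with
    | none => exact absurd ((h.arrival.assigned i).1 hsi) (by have := i.2; omega)
    | some j => exact ⟨j, mem_univ _, rfl⟩
  rw [card_eq_sum_card_fiberwise hmaps]
  refine le_trans (sum_le_card_nsmul _ _ (⌈(2 - α) / (α - 1) ^ 2⌉₊ + 4) ?_) ?_
  · intro o ho
    obtain ⟨j, -, rfl⟩ := mem_image.1 ho
    exact hfib j
  · rw [card_image_of_injective _ (Option.some_injective _), card_univ, Fintype.card_fin,
      smul_eq_mul, mul_comm]

end Instance


/-! ### The reassignment step. -/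

section Instance

variable {n m : ℕ} {α : ℝ} {p : Fin n → ℝ}

lemma threshold_le (hm : 0 < m) (hα : 4 / 3 ≤ α) (hp : ∀ i, 0 ≤ p i) (j : Fin m) :
    threshold α p j ≤ α * opt m p := by
  have hL := lowerBound_le_opt hm hp
  have hL0 := lowerBound_nonneg (m := m) hp n
  have hm0 : (0 : ℝ) < m := by exact_mod_cast hm
  have hS0 := smallAverage_nonneg hm hα hp n
  have hS : smallAverage m α p n ≤ opt m p := by
    classical
    refine le_of_mul_le_mul_left ?_ hm0
    rw [mul_smallAverage hm hα hp]
    exact (sum_le_sum_of_subset_of_nonneg (filter_subset _ _) fun i _ _ => hp i).trans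
      (sum_le_mul_opt hm p)
  apply max_le
  · rw [beta_eq_weight (by linarith)]
    exact mul_le_mul (weight_le α) hS hS0 (by linarith)
  · exact mul_le_mul (by linarith) hL hL0 (by linarith)

/-- A set of total length `x` that is assigned after `k` others keeps the makespan bound. -/
def Fits (m : ℕ) (α : ℝ) (p : Fin n → ℝ) (k : ℕ) (x : ℝ) : Prop :=
  x ≤ (α - 1) * opt m p ∨
    k < m ∧ ∀ j : Fin m, j.val ≤ k → threshold α p j + x ≤ α * opt m p

/-- What is known in the reassignment step when `k` sets have been assigned. -/
structure ReassignInvariant (α : ℝ) (p : Fin n → ℝ) (k : ℕ) (s : Sched n m)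
    (Bs : List (Finset (Fin n))) : Prop where
  unassigned : ∀ i, s i = none ↔ ∃ B ∈ Bs, i ∈ B
  disjoint : Bs.Pairwise Disjoint
  load_le : ∀ j, load p s j ≤ α * opt m p
  untouched : ∃ U : Finset (Fin m), #U ≤ k ∧ ∀ j ∉ U, load p s j ≤ threshold α p j
  fits : ∀ l (hl : l < Bs.length), Fits m α p (k + l) (∑ i ∈ Bs[l], p i)

lemma load_place {s : Sched n m} {B : Finset (Fin n)} (hB : ∀ i ∈ B, s i = none) (j j' : Fin m) :
    load p (place s B j) j' = load p s j' + if j' = j then ∑ i ∈ B, p i else 0 := by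
  unfold load place
  split_ifs with h
  · subst h
    rw [← sum_union]
    · apply sum_congr _ fun _ _ => rfl
      ext i
      by_cases hi : i ∈ B <;> simp [hi]
    · rw [disjoint_left]
      intro i hi hiB
      simp [hB i hiB] at hi
  · rw [add_zero]
    apply sum_congr _ fun _ _ => rfl
    ext i
    by_cases hi : i ∈ B
    · simp [hi, hB i hi, Ne.symm h]
    · simp [hi]

lemma ReassignInvariant.place (hm : 0 < m) (hp : ∀ i, 0 ≤ p i) {k : ℕ} {s : Sched n m}
    {B : Finset (Fin n)} {Bs : List (Finset (Fin n))} (h : ReassignInvariant α p k s (B :: Bs))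
    {j : Fin m} (hj : IsLeastLoaded p s j) :
    ReassignInvariant α p (k + 1) (place s B j) Bs := by
  have hm0 : (0 : ℝ) < m := by exact_mod_cast hm
  have hB : ∀ i ∈ B, s i = none := fun i hi => (h.unassigned i).2 ⟨B, List.mem_cons_self, hi⟩
  have hdisj := List.pairwise_cons.1 h.disjoint
  obtain ⟨U, hU, hUT⟩ := h.untouched
  refine ⟨?_, hdisj.2, ?_, ⟨insert j U, ?_, ?_⟩, ?_⟩
  · intro i
    unfold MakespanMigration.place
    by_cases hi : i ∈ B
    · simp only [hi, if_true, reduceCtorEq, false_iff]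
      rintro ⟨B', hB', hi'⟩
      exact disjoint_left.1 (hdisj.1 B' hB') hi hi'
    · simp [hi, h.unassigned i]
  · intro j'
    rw [load_place hB]
    split_ifs with hjj
    · subst hjj
      have hf := h.fits 0 (by simp)
      rw [List.getElem_cons_zero, add_zero] at hf
      rcases hf with hf | ⟨hk, hf⟩
      · have hle : load p s j' ≤ opt m p := by
          refine le_of_mul_le_mul_left ?_ hm0
          refine hj.mul_load_le.trans (le_trans ?_ (sum_le_mul_opt hm p))
          exact sum_le_sum_of_subset_of_nonneg (filter_subset _ _) fun i _ _ => hp i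
        linarith
      · have hc : #U < #(univ.filter fun x : Fin m => x.val < k + 1) := by
          rw [Fin.card_filter_val_lt]
          omega
        obtain ⟨j₀, hj₀, hj₀U⟩ := exists_mem_notMem_of_card_lt_card hc
        have h1 := hf j₀ (by simpa [Nat.lt_succ_iff] using hj₀)
        have h2 := hUT j₀ hj₀U
        have h3 := hj j₀
        linarith
    · rw [add_zero]
      exact h.load_le j'
  · exact (card_insert_le _ _).trans (by omega)
  · intro j' hj'
    rw [mem_insert, not_or] at hj'
    rw [load_place hB, if_neg hj'.1, add_zero]
    exact hUT j' hj'.2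
  · intro l hl
    have := h.fits (l + 1) (by simpa using hl)
    rw [List.getElem_cons_succ] at this
    rwa [add_assoc, add_comm 1 l]

/-- The volume argument: the machines with small weight can take one of the `k` longest sets. -/
lemma weight_mul_add_le {k : ℕ} (hm : 0 < m) (hα : 1 < α) {S x O : ℝ} (hS : 0 ≤ S)
    (hxO : x ≤ O) (hx : 0 ≤ x) (hvol : m * S + (k + 1) * x ≤ m * O) :
    weight m k α * S + x ≤ α * O := by
  have hm0 : (0 : ℝ) < m := by exact_mod_cast hm
  rcases le_total (((k : ℝ) + 1) * α) m with h | h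
  · have hk1 : ((k : ℝ) + 1) < m := by nlinarith [show (0 : ℝ) ≤ k by positivity]
    have hk1' : k + 1 < m := by exact_mod_cast hk1
    have hw : weight m k α ≤ (α - 1) * ((m : ℝ) / ((m : ℝ) - ((k : ℝ) + 1))) := by
      unfold weight
      rw [if_pos hk1']
      exact min_le_left _ _
    have hpos : (0 : ℝ) < (m : ℝ) - ((k : ℝ) + 1) := by linarith
    have h1 : weight m k α * S ≤ (α - 1) * (m * S) / ((m : ℝ) - ((k : ℝ) + 1)) := by
      calc weight m k α * S ≤ (α - 1) * ((m : ℝ) / ((m : ℝ) - ((k : ℝ) + 1))) * S :=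
            mul_le_mul_of_nonneg_right hw hS
        _ = _ := by ring
    have h2 : (α - 1) * (m * S) / ((m : ℝ) - ((k : ℝ) + 1)) ≤ α * O - x := by
      rw [div_le_iff₀ hpos]
      -- With mS ≤ mO - (k+1)x inserted, the slack is exactly (m - (k+1)α)(O - x).
      nlinarith [mul_nonneg (sub_nonneg.2 h) (sub_nonneg.2 hxO),
        mul_le_mul_of_nonneg_left hvol (show 0 ≤ α - 1 by linarith)]
    linarith
  · have h1 : weight m k α * S ≤ α * S := mul_le_mul_of_nonneg_right (weight_le α) hS
    have h2 : m * (α * S + x) ≤ m * (α * O) := by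
      nlinarith [mul_le_mul_of_nonneg_left hvol (show 0 ≤ α by linarith),
        mul_le_mul_of_nonneg_right h hx]
    linarith [le_of_mul_le_mul_left h2 hm0]

section PairSets

variable {R : Finset (Fin n)} {r : List (Fin n)}

lemma mem_pairSet {i : Fin m} {x : Fin n} : x ∈ pairSet p r i ↔ r[i.val]? = some x ∨
    (r[2 * m - 1 - i.val]? = some x ∧ ∃ y, r[i.val]? = some y ∧ p y / 2 < p x) := by
  simp [pairSet]

lemma mem_of_mem_pairSet {i : Fin m} {x : Fin n} (hx : x ∈ pairSet p r i) : x ∈ r := by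
  rcases mem_pairSet.1 hx with h | ⟨h, -⟩ <;> exact List.mem_of_getElem? h

lemma getElem?_inj_of_nodup (hr : r.Nodup) {u v : ℕ} {x : Fin n} (hu : r[u]? = some x)
    (hv : r[v]? = some x) : u = v := by
  rw [List.getElem?_eq_some_iff] at hu hv
  obtain ⟨hu, h1⟩ := hu
  obtain ⟨hv, h2⟩ := hv
  exact hr.getElem_inj_iff.1 (h1.trans h2.symm)

lemma pairSet_disjoint (hr : r.Nodup) {i i' : Fin m} (hne : i ≠ i') :
    Disjoint (pairSet p r i) (pairSet p r i') := by
  have hne' : i.val ≠ i'.val := fun h => hne (Fin.ext h)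
  have h1 := i.2
  have h2 := i'.2
  rw [disjoint_left]
  intro x hx hx'
  rcases mem_pairSet.1 hx with h | ⟨h, -⟩ <;> rcases mem_pairSet.1 hx' with h' | ⟨h', -⟩ <;>
  · have := getElem?_inj_of_nodup hr h h'
    omega

/-- If the optimum is not at least the sum of the pair, it is at least 3y. As y > x/2, this again
exceeds x + y. -/
lemma sum_pairSet_le_opt (hm : 0 < m) (hp : ∀ i, 0 ≤ p i) (hr : r.Nodup)
    (hs : r.Pairwise fun i i' => p i' ≤ p i) (i : Fin m) :
    ∑ x ∈ pairSet p r i, p x ≤ opt m p := by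
  cases hx : r[i.val]? with
  | none =>
    have : pairSet p r i = ∅ := by
      ext y
      rw [mem_pairSet, hx]
      simp
    rw [this, sum_empty]
    exact opt_nonneg hm hp
  | some x =>
    by_cases hy : ∃ y, r[2 * m - 1 - i.val]? = some y ∧ p x / 2 < p y
    · obtain ⟨y, hy, hxy⟩ := hy
      have hsub : pairSet p r i ⊆ {x, y} := by
        intro z hz
        rw [mem_insert, mem_singleton]
        rcases mem_pairSet.1 hz with h | ⟨h, -⟩
        · exact Or.inl (Option.some.inj (h.symm.trans hx))
        · exact Or.inr (Option.some.inj (h.symm.trans hy))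
      have hne : x ≠ y := by
        rintro rfl
        have := getElem?_inj_of_nodup hr hx hy
        have := i.2
        omega
      refine (sum_le_sum_of_subset_of_nonneg hsub fun i _ _ => hp i).trans ?_
      rw [sum_pair hne]
      rcases pair_le_opt hm hp hr hs i.2 hx hy with h | h
      · exact h
      · linarith
    · have hsub : pairSet p r i ⊆ {x} := by
        intro z hz
        rw [mem_singleton]
        rcases mem_pairSet.1 hz with h | ⟨h, y, h', hlt⟩
        · exact Option.some.inj (h.symm.trans hx)
        · exact absurd ⟨z, h, by rwa [← Option.some.inj (hx.symm.trans h')] at hlt⟩ hy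
      refine (sum_le_sum_of_subset_of_nonneg hsub fun i _ _ => hp i).trans ?_
      rw [sum_singleton]
      exact le_opt hm hp x

/-- A job of rank m+1 to 2m outside all pairs has length at most half of its partner's, so both
alternatives of `pair_le_opt` give the bound. A job of later rank is the shortest of at least 2m+1
jobs. -/
lemma three_mul_le_opt_of_notMem_pairSet (hm : 0 < m) (hp : ∀ i, 0 ≤ p i) (hr : r.Nodup)
    (hs : r.Pairwise fun i i' => p i' ≤ p i) {x : Fin n} (hx : x ∈ r)
    (hnot : ∀ k : Fin m, x ∉ pairSet p r k) : 3 * p x ≤ opt m p := by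
  obtain ⟨u, hu⟩ := List.getElem?_of_mem hx
  have hum : m ≤ u := by
    by_contra! h
    exact hnot ⟨u, h⟩ (mem_pairSet.2 (Or.inl hu))
  obtain ⟨hul, hux⟩ := List.getElem?_eq_some_iff.1 hu
  rcases lt_or_ge u (2 * m) with h2 | h2
  · have hk : 2 * m - 1 - u < m := by omega
    have hkl : 2 * m - 1 - u < r.length := by omega
    have hy : r[2 * m - 1 - u]? = some r[2 * m - 1 - u] := List.getElem?_eq_getElem hkl
    have hu' : r[2 * m - 1 - (2 * m - 1 - u)]? = some x := by
      rw [show 2 * m - 1 - (2 * m - 1 - u) = u by omega, hu]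
    have hle : p x ≤ p r[2 * m - 1 - u] / 2 := by
      by_contra! hlt
      exact hnot ⟨2 * m - 1 - u, hk⟩ (mem_pairSet.2 (Or.inr ⟨hu', _, hy, hlt⟩))
    rcases pair_le_opt hm hp hr hs hk hy hu' with h | h
    · linarith
    · exact h
  · refine three_mul_le_opt hm hp (S := (r.take (u + 1)).toFinset) ?_ ?_
    · rw [List.toFinset_card_of_nodup (hr.sublist (List.take_sublist _ _)), List.length_take]
      omega
    · intro y hy
      rw [List.mem_toFinset, List.mem_take_iff_getElem] at hy
      obtain ⟨v, hv, rfl⟩ := hy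
      rw [← hux]
      rcases (show v ≤ u by omega).eq_or_lt with rfl | hvu
      · exact le_rfl
      · exact List.pairwise_iff_getElem.1 hs v u _ _ hvu

end PairSets

/-- The first m positions, empty sets included, use the volume bound, with the sets ordered by
total. Later positions hold single jobs that are small or at most O/3 ≤ (α-1)O. -/
lemma fits_of_isReassignmentOrder (hm : 0 < m) (hα : 4 / 3 ≤ α) (hp : ∀ i, 0 ≤ p i)
    {R : Finset (Fin n)} {Bs : List (Finset (Fin n))} (hBs : IsReassignmentOrder m α p R Bs)
    (l : ℕ) (hl : l < Bs.length) : Fits m α p l (∑ i ∈ Bs[l], p i) := by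
  classical
  obtain ⟨r, π, q, ⟨hr, hmem, hs⟩, hanti, hq, hqmem, rfl⟩ := hBs
  have hα1 : 1 < α := by linarith
  have hO := opt_nonneg hm hp
  have hL := lowerBound_le_opt hm hp
  by_cases hlm : l < m
  · right
    refine ⟨hlm, ?_⟩
    rw [List.getElem_append_left (by simpa using hlm), List.getElem_ofFn]
    set P : Fin m → Finset (Fin n) := fun k => pairSet p r (π k) with hP
    set x := ∑ i ∈ pairSet p r (π ⟨l, hlm⟩), p i with hx
    have hxO : x ≤ opt m p := sum_pairSet_le_opt hm hp hr hs _
    have hx0 : 0 ≤ x := sum_nonneg fun i _ => hp i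
    have hvol : m * smallAverage m α p n + (l + 1) * x ≤ m * opt m p := by
      refine le_trans ?_ (sum_le_mul_opt hm p)
      set F := univ.filter fun k : Fin m => k.val < l + 1 with hF
      have hFc : #F = l + 1 := by rw [hF, Fin.card_filter_val_lt]; omega
      have h1 : (l + 1) * x ≤ ∑ k ∈ F, ∑ i ∈ P k, p i := by
        have := card_nsmul_le_sum F (fun k => ∑ i ∈ P k, p i) x fun k hk => hanti (by
          rw [Fin.le_def]
          have := (mem_filter.1 hk).2
          simp only
          omega)
        rw [hFc, nsmul_eq_mul] at this
        exact_mod_cast this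
      rw [← sum_biUnion fun k _ k' _ hne => pairSet_disjoint hr fun h => hne (π.injective h)] at h1
      rw [mul_smallAverage hm hα hp]
      refine le_trans (add_le_add le_rfl h1) ?_
      rw [← sum_union]
      · exact sum_le_sum_of_subset_of_nonneg (subset_univ _) fun i _ _ => hp i
      · rw [disjoint_left]
        intro i hi hi'
        rw [mem_biUnion] at hi'
        obtain ⟨k, -, hk⟩ := hi'
        exact ((hmem i).1 (mem_of_mem_pairSet hk)).2 (mem_filter.1 hi).2.2
    have hS := smallAverage_nonneg hm hα hp n
    have hkey := weight_mul_add_le hm hα1 hS hxO hx0 hvol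
    intro j hj
    have hw := mul_le_mul_of_nonneg_right (weight_mono hj hα1 (m := m)) hS
    rw [← le_sub_iff_add_le]
    apply max_le
    · rw [beta_eq_weight hα1]
      linarith
    · nlinarith
  · left
    rw [List.getElem_append_right (by simpa using hlm), List.getElem_map, sum_singleton]
    set i := q[l - (List.ofFn fun k => pairSet p r (π k)).length]'(by
      simp at hl ⊢; omega) with hi
    obtain ⟨hiR, hnot⟩ := (hqmem i).1 (List.getElem_mem _)
    by_cases hsm : IsSmallAt m α p n (p i)
    · exact le_trans hsm (mul_le_mul_of_nonneg_left hL (by linarith))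
    · have := three_mul_le_opt_of_notMem_pairSet hm hp hr hs ((hmem i).2 ⟨hiR, hsm⟩) hnot
      nlinarith

lemma RemovalInvariant.startReassign (hm : 0 < m) (hα : 4 / 3 ≤ α) (hp : ∀ i, 0 ≤ p i)
    {s₀ s : Sched n m} {R : Finset (Fin n)} {Bs : List (Finset (Fin n))}
    (h : RemovalInvariant α p s₀ s R) (hload : ∀ j, ¬ Overloaded α p s j)
    (hBs : IsReassignmentOrder m α p R Bs) : ReassignInvariant α p 0 s Bs := by
  have hload' : ∀ j, load p s j ≤ threshold α p j := fun j => not_lt.1 (hload j)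
  refine ⟨?_, ?_, fun j => (hload' j).trans (threshold_le hm hα hp j),
    ⟨∅, by simp, fun j _ => hload' j⟩, ?_⟩
  · intro i
    rw [h.eq_none_iff]
    obtain ⟨r, π, q, ⟨hr, hmem, hs⟩, hanti, hq, hqmem, rfl⟩ := hBs
    constructor
    · intro hi
      by_cases hk : ∃ k : Fin m, i ∈ pairSet p r k
      · obtain ⟨k, hk⟩ := hk
        refine ⟨pairSet p r k, List.mem_append_left _ ?_, hk⟩
        rw [List.mem_ofFn]
        exact ⟨π.symm k, by simp⟩
      · push Not at hk
        refine ⟨{i}, List.mem_append_right _ ?_, by simp⟩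
        exact List.mem_map.2 ⟨i, (hqmem i).2 ⟨hi, hk⟩, rfl⟩
    · rintro ⟨B, hB, hi⟩
      rcases List.mem_append.1 hB with hB | hB
      · obtain ⟨k, rfl⟩ := List.mem_ofFn.1 hB
        exact ((hmem i).1 (mem_of_mem_pairSet hi)).1
      · obtain ⟨x, hx, rfl⟩ := List.mem_map.1 hB
        rw [mem_singleton.1 hi]
        exact ((hqmem x).1 hx).1
  · obtain ⟨r, π, q, ⟨hr, hmem, hs⟩, hanti, hq, hqmem, rfl⟩ := hBs
    rw [List.pairwise_append]
    refine ⟨?_, ?_, ?_⟩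
    · rw [List.pairwise_ofFn]
      exact fun k k' hkk => pairSet_disjoint hr fun h => hkk.ne (π.injective h)
    · rw [List.pairwise_map]
      exact hq.imp fun hne => disjoint_singleton.2 hne
    · intro B hB B' hB'
      obtain ⟨k, rfl⟩ := List.mem_ofFn.1 hB
      obtain ⟨x, hx, rfl⟩ := List.mem_map.1 hB'
      rw [disjoint_singleton_right]
      exact ((hqmem x).1 hx).2 _
  · intro l hl
    rw [zero_add]
    exact fits_of_isReassignmentOrder hm hα hp hBs l hl

/-! ### Global invariant, progress and termination. -/

lemma exists_isReassignmentOrder (m : ℕ) (α : ℝ) (p : Fin n → ℝ) (R : Finset (Fin n)) :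
    ∃ Bs, IsReassignmentOrder m α p R Bs := by
  classical
  set le : Fin n → Fin n → Bool := fun i i' => decide (p i' ≤ p i) with hle
  set r := (R.filter fun i => ¬ IsSmallAt m α p n (p i)).toList.mergeSort le with hr
  have hperm := List.mergeSort_perm (R.filter fun i => ¬ IsSmallAt m α p n (p i)).toList le
  set σ := Tuple.sort fun k : Fin m => - ∑ i ∈ pairSet p r k, p i with hσ
  refine ⟨_, r, σ, (R.filter fun i => ∀ k : Fin m, i ∉ pairSet p r k).toList, ⟨?_, ?_, ?_⟩, ?_,
    nodup_toList _, by simp, rfl⟩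
  · exact hperm.nodup_iff.2 (nodup_toList _)
  · intro i
    rw [hperm.mem_iff]
    simp
  · refine (List.pairwise_mergeSort (le := le) ?_ ?_ _).imp fun h => by simpa [hle] using h
    · intro a b c hab hbc
      simp only [hle, decide_eq_true_eq] at *
      exact hbc.trans hab
    · intro a b
      simp only [hle, Bool.or_eq_true, decide_eq_true_eq]
      exact le_total _ _
  · intro k k' hkk
    have := Tuple.monotone_sort (fun k : Fin m => - ∑ i ∈ pairSet p r k, p i) hkk
    simpa using this

/-- A property of all configurations that the algorithm reaches. -/
def Invariant (α : ℝ) (p : Fin n → ℝ) : Config n m → Prop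
  | .arrival t s => t ≤ n ∧ ArrivalInvariant α p t s
  | .removal s R => ∃ s₀, RemovalInvariant α p s₀ s R
  | .reassign s R Bs => #R ≤ (⌈(2 - α) / (α - 1) ^ 2⌉₊ + 4) * m ∧ ∃ k, ReassignInvariant α p k s Bs
  | .done s R => #R ≤ (⌈(2 - α) / (α - 1) ^ 2⌉₊ + 4) * m ∧ (∀ i, s i ≠ none) ∧
      ∀ j, load p s j ≤ α * opt m p

lemma Invariant.step (hm : 0 < m) (hα : 4 / 3 ≤ α) (hp : ∀ i, 0 ≤ p i) {c c' : Config n m}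
    (hc : Invariant α p c) (h : Step α p c c') : Invariant α p c' := by
  cases h with
  | assignSmall t s j hsmall hj =>
    exact ⟨t.2, hc.2.place j (fun _ => hj) fun h => absurd hsmall h⟩
  | assignLarge t s j hlarge hj =>
    exact ⟨t.2, hc.2.place j (fun h => absurd h hlarge)
      fun _ => hc.2.load_le_lowerBound hm hp hj⟩
  | startRemoval s => exact ⟨s, RemovalInvariant.start hc.2⟩
  | remove s R j i hj hi hmax =>
    obtain ⟨s₀, hc⟩ := hc
    exact ⟨s₀, hc.remove hj hi hmax⟩
  -- The bound on |R| is recorded here, since the later invariant forgets the schedule s₀ before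
  -- removals.
  | startReassign s R Bs hload hBs =>
    obtain ⟨s₀, hc⟩ := hc
    exact ⟨hc.card_le hα hm hp, 0, hc.startReassign hm hα hp hload hBs⟩
  | assignSet s R B Bs j hj =>
    obtain ⟨hR, k, hc⟩ := hc
    exact ⟨hR, k + 1, hc.place hm hp hj⟩
  | finish s R =>
    obtain ⟨hR, k, hc⟩ := hc
    exact ⟨hR, fun i hi => by simpa using (hc.unassigned i).1 hi, hc.load_le⟩

lemma Reachable.invariant (hm : 0 < m) (hα : 4 / 3 ≤ α) (hp : ∀ i, 0 ≤ p i) {c : Config n m}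
    (h : Reachable α p c) : Invariant α p c := by
  induction h with
  | refl => exact ⟨Nat.zero_le _, ArrivalInvariant.init α p⟩
  | tail _ hstep ih => exact ih.step hm hα hp hstep

lemma Invariant.progress (hm : 2 ≤ m) (hα : 4 / 3 ≤ α) (hf : f m α = 1) (hp : ∀ i, 0 ≤ p i)
    {c : Config n m} (hc : Invariant α p c) :
    (∃ s R, c = .done s R) ∨ ∃ c' : Config n m, Step α p c c' := by
  have hm0 : 0 < m := by omega
  cases c with
  | arrival t s =>
    right
    obtain ⟨htn, hs⟩ := hc
    rcases htn.eq_or_lt with rfl | htn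
    · exact ⟨_, .startRemoval s⟩
    · by_cases hsm : IsSmallAt m α p (t + 1) (p ⟨t, htn⟩)
      · obtain ⟨j, hj⟩ := hs.exists_machine hm hα hf hp
        exact ⟨_, .assignSmall ⟨t, htn⟩ s j hsm hj⟩
      · obtain ⟨j, hj⟩ := exists_isLeastLoaded hm0 p s
        exact ⟨_, .assignLarge ⟨t, htn⟩ s j hsm hj⟩
  | removal s R =>
    right
    by_cases h : ∃ j, Overloaded α p s j
    · obtain ⟨j, hj⟩ := h
      have hne : (univ.filter fun i => s i = some j).Nonempty := by
        rw [nonempty_iff_ne_empty]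
        intro he
        have h1 : load p s j = 0 := by unfold load; rw [he, sum_empty]
        have h2 : (α - 1) * lowerBound m p n < load p s j := (le_max_right _ _).trans_lt hj
        rw [h1] at h2
        exact absurd h2 (not_lt.2 (mul_nonneg (by linarith) (lowerBound_nonneg hp n)))
      obtain ⟨i, hi, hmax⟩ := exists_max_image _ p hne
      exact ⟨_, .remove s R j i hj (by simpa using hi) fun i' hi' => hmax i' (by simpa using hi')⟩
    · push Not at h
      obtain ⟨Bs, hBs⟩ := exists_isReassignmentOrder m α p R
      exact ⟨_, .startReassign s R Bs h hBs⟩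
  | reassign s R Bs =>
    right
    cases Bs with
    | nil => exact ⟨_, .finish s R⟩
    | cons B Bs =>
      obtain ⟨j, hj⟩ := exists_isLeastLoaded hm0 p s
      exact ⟨_, .assignSet s R B Bs j hj⟩
  | done s R => exact Or.inl ⟨s, R, rfl⟩

/-- The phase of a configuration and a bound on the number of steps left in this phase. -/
def Config.rank : Config n m → ℕ ×ₗ ℕ
  | .arrival t _ => toLex (3, n - t)
  | .removal s _ => toLex (2, #{i | s i ≠ none})
  | .reassign _ _ Bs => toLex (1, Bs.length)
  | .done _ _ => toLex (0, 0)

lemma Step.rank_lt {c c' : Config n m} (h : Step α p c c') : c'.rank < c.rank := by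
  cases h with
  | assignSmall t s j hsmall hj =>
    exact Prod.Lex.toLex_lt_toLex.2 (Or.inr ⟨rfl, by have := t.2; simp only; omega⟩)
  | assignLarge t s j hlarge hj =>
    exact Prod.Lex.toLex_lt_toLex.2 (Or.inr ⟨rfl, by have := t.2; simp only; omega⟩)
  | startRemoval s => exact Prod.Lex.toLex_lt_toLex.2 (Or.inl (by simp))
  | remove s R j i hj hi hmax =>
    have hsub : (univ.filter fun x => Function.update s i none x ≠ none) ⊂
        univ.filter fun x => s x ≠ none := by
      rw [ssubset_iff_of_subset]
      · exact ⟨i, by simp [hi], by simp⟩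
      · intro x
        by_cases hx : x = i <;> simp [hx]
    refine Prod.Lex.toLex_lt_toLex.2 (Or.inr ⟨rfl, ?_⟩)
    have := card_lt_card hsub
    convert this using 2
  | startReassign s R Bs hload hBs => exact Prod.Lex.toLex_lt_toLex.2 (Or.inl (by simp))
  | assignSet s R B Bs j hj =>
    exact Prod.Lex.toLex_lt_toLex.2 (Or.inr ⟨rfl, by simp⟩)
  | finish s R => exact Prod.Lex.toLex_lt_toLex.2 (Or.inl (by simp))

lemma acc_step (α : ℝ) (p : Fin n → ℝ) (c : Config n m) :
    Acc (fun c' c : Config n m => Step α p c c') c :=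
  (Subrelation.wf (fun h => Step.rank_lt h)
    (InvImage.wf (Config.rank (n := n) (m := m)) wellFounded_lt)).apply c

end Instance

/-! ### The theorem assembled. -/

lemma isCompetitive {m : ℕ} (hm : 2 ≤ m) {α : ℝ} (hα : 4 / 3 ≤ α) (hf : f m α = 1) :
    IsCompetitive m α α := by
  intro n p hp
  have hm0 : 0 < m := by omega
  refine ⟨⟨fun c hc => (hc.invariant hm0 hα hp).progress hm hα hf hp, acc_step α p _⟩, ?_⟩
  intro s R h
  obtain ⟨-, hsome, hload⟩ := h.invariant hm0 hα hp
  choose a ha using fun i => Option.ne_none_iff_exists'.1 (hsome i)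
  refine ⟨a, ha, ?_⟩
  have : Nonempty (Fin m) := ⟨⟨0, hm0⟩⟩
  refine ciSup_le fun j => le_trans (le_of_eq ?_) (hload j)
  unfold load
  simp only [ha, Option.some.injEq]

lemma migratesAtMost {m : ℕ} (hm : 0 < m) {α : ℝ} (hα : 4 / 3 ≤ α) (hα2 : α ≤ 2) :
    MigratesAtMost m α ((⌈(2 - α) / (α - 1) ^ 2⌉ + 4) * (m : ℤ)) := by
  intro n p hp s R h
  obtain ⟨hR, -, -⟩ := h.invariant hm hα hp
  have h0 : 0 ≤ (2 - α) / (α - 1) ^ 2 := div_nonneg (by linarith) (sq_nonneg _)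
  -- α ≤ 2 makes the quotient nonnegative, so its natural and integer ceilings agree.
  rw [← Int.natCast_ceil_eq_ceil h0]
  exact_mod_cast hR

end MakespanMigration

theorem theorem1 (m : ℕ) (hm : 2 ≤ m) :
    (∃! α : ℝ, 1 < α ∧ MakespanMigration.f m α = 1) ∧
    ∀ α : ℝ, 1 < α → MakespanMigration.f m α = 1 →
      MakespanMigration.IsCompetitive m α α ∧
      MakespanMigration.MigratesAtMost m α ((⌈(2 - α) / (α - 1) ^ 2⌉ + 4) * (m : ℤ)) ∧
      (11 ≤ m → (⌈(2 - α) / (α - 1) ^ 2⌉ + 4) * (m : ℤ) ≤ 7 * (m : ℤ)) := by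
  refine ⟨MakespanMigration.existsUnique_f_eq_one hm, fun α hα hf => ?_⟩
  have h43 := MakespanMigration.le_of_f_le_one hm hα hf (MakespanMigration.f_four_thirds_le hm)
  refine ⟨MakespanMigration.isCompetitive hm h43 hf, MakespanMigration.migratesAtMost (by omega) h43
    (MakespanMigration.le_two_of_f_eq_one hm hf), fun h11 => ?_⟩
  have := MakespanMigration.ceil_le_three h11 hα hf
  exact mul_le_mul_of_nonneg_right (by linarith) (by positivity)
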